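/- **Setting.** Spacetime is four-dimensional with coordinates $x^\mu$ and Minkowski metric $\eta=\mathrm{diag}(1,-1,-1,-1)$; let $\mathfrak g$ be a finite-dimensional real Lie algebra with basis $(e_a)$ and structure constants $[e_b,e_c]=f^a{}_{bc}e_a$, color indices being raised and lowered with $\delta_{ab}$. Let $\varkappa,\zeta,\xi,\alpha$ be nonzero real numbers and $\mathrm g$ a real number. The fields are the metric $g_{\mu\nu}=g_{\nu\mu}=\eta_{\mu\nu}+\alpha h_{\mu\nu}$ ($h$ the graviton), the graviton-ghost $C^\rho$, graviton-antighost $\overline C^\rho$ and auxiliary field $B^\rho$, the gauge field $A^a_\mu$, gauge ghost $c^a$, gauge antighost $\overline c^a$ and auxiliary field $b^a$, and finitely many further bosonic or fermionic components $\varphi^i$ that form tensor (density) fields in a representation of $\mathfrak g$. The ghosts, the antighosts and the fermionic $\varphi^i$ are odd and anticommute with each other; all other fields are even. Let $\mathcal A$ be the real supercommutative algebra of polynomials in all partial derivatives (of order $\ge 0$) of all these fields and in $1/\sqrt{-\det g}$; it contains $g^{\mu\nu}$ and $\sqrt{-\det g}$. Let $\partial_\mu$ be the total derivatives on $\mathcal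 A$, write $dV_\eta=dt\wedge dx\wedge dy\wedge dz$, $dV_g=\sqrt{-\det g}\,dV_\eta$, and identify a density $L\,dV_\eta$, $L\in\mathcal A$, with $L$. Write $\simeq$ for equality modulo total derivatives: $L\simeq L'$ iff $L-L'=\partial_\mu J^\mu$ for some $J^\mu\in\mathcal A$. **Operators.** $P,\overline P,Q,\overline Q$ are the odd derivations of $\mathcal A$ (acting from the left) that commute with all $\partial_\mu$ and are given on the fields as follows, with $\pounds$ the Lie derivative and $\varphi$ a further field. - $P g_{\mu\nu}=\varkappa\,(\pounds_C g)_{\mu\nu}=\varkappa\big(C^\rho\partial_\rho g_{\mu\nu}+(\partial_\mu C^\rho)g_{\rho\nu}+(\partial_\nu C^\rho)g_{\mu\rho}\big)$, $\;P C^\rho=\varkappa C^\sigma\partial_\sigma C^\rho$, $\;P\overline C^\rho=\tfrac1\zeta B^\rho$, $\;PB^\rho=0$, and $P\psi=\varkappa\pounds_C\psi$ for $\psi\in\{A_\mu^a,c^a,\overline c^a,b^a,\varphi\}$. - $\overline P g_{\mu\nu}=\varkappa(\pounds_{\overline C}g)_{\mu\nu}$, $\;\overline P C^\rho=-\tfrac1\zeta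 B^\rho+\varkappa\big(\overline C^\sigma\partial_\sigma C^\rho-(\partial_\sigma\overline C^\rho)C^\sigma\big)$, $\;\overline P\,\overline C^\rho=\varkappa\overline C^\sigma\partial_\sigma\overline C^\rho$, $\;\overline P B^\rho=\varkappa\big(\overline C^\sigma\partial_\sigma B^\rho-(\partial_\sigma\overline C^\rho)B^\sigma\big)$, and $\overline P\psi=\varkappa\pounds_{\overline C}\psi$ for $\psi\in\{A_\mu^a,c^a,\overline c^a,b^a,\varphi\}$. - $Q A^a_\mu=\tfrac1\xi\partial_\mu c^a+\mathrm g f^a{}_{bc}c^bA^c_\mu$, $\;Qc^a=\tfrac{\mathrm g}2f^a{}_{bc}c^bc^c$, $\;Q\overline c^a=\tfrac1\xi b^a$, $\;Qb^a=0$, $\;Q\varphi=\mathrm g\,c^a(e_a\cdot\varphi)$, and $Q$ vanishes on $g_{\mu\nu},C^\rho,\overline C^\rho,B^\rho$. - $\overline Q A^a_\mu=\tfrac1\xi\partial_\mu\overline c^a+\mathrm g f^a{}_{bc}\overline c^bA^c_\mu$, $\;\overline Qc^a=-\tfrac1\xi b^a+\mathrm g f^a{}_{bc}\overline c^bc^c$,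 $\;\overline Q\,\overline c^a=\tfrac{\mathrm g}2f^a{}_{bc}\overline c^b\overline c^c$, $\;\overline Qb^a=\mathrm g f^a{}_{bc}\overline c^bb^c$, $\;\overline Q\varphi=\mathrm g\,\overline c^a(e_a\cdot\varphi)$, and $\overline Q$ vanishes on $g_{\mu\nu},C^\rho,\overline C^\rho,B^\rho$. Put $D=P+Q$, $\overline D=\overline P+\overline Q$, $\mathcal P=P\circ\overline P$, $\mathcal Q=Q\circ\overline Q$, $\mathcal D=D\circ\overline D$. The gauge fixing bosons are $$F=-\frac\zeta4\Big(\frac1\varkappa\eta^{\mu\nu}h_{\mu\nu}-\overline C^\rho\eta_{\rho\sigma}C^\sigma\Big)dV_\eta,\qquad G=-\frac\xi2\Big(\delta_{ab}g^{\mu\nu}A^a_\mu A^b_\nu-\overline c_ac^a\Big)dV_g,\qquad B=F+G,$$ and the symmetric gauge fixing and ghost Lagrange densities (auxiliary fields included) are $\mathcal L_{\mathrm{GR\text{-}GF\text{-}Ghost}}=\mathcal PF$ and $\mathcal L_{\mathrm{YM\text{-}GF\text{-}Ghost}}=\mathcal QG$. **Theorem.** The total super-BRST operator generates the complete gauge fixing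 and ghost Lagrange density from the total gauge fixing boson: $$\mathcal L_{\mathrm{GR\text{-}GF\text{-}Ghost}}+\mathcal L_{\mathrm{YM\text{-}GF\text{-}Ghost}}\;\simeq\;\mathcal D B .$$ -/

import Mathlib

open scoped TensorProduct

namespace BRST

noncomputable section

/-! ### Field content

Spacetime has four dimensions; Lorentz indices are elements of `Fin 4`.  Color indices are elements
of `ι`, the components of the other bosonic (fermionic) particle fields are indexed by `I₀` (`I₁`).
-/

/-- Components of the even fields: metric `g_{μν}` (one for each unordered pair of indices), graviton
auxiliary field `B^ρ`, gauge field `A^a_μ`, gauge auxiliary field `b^a`, other even fields. -/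
inductive EvenField (ι I₀ : Type*)
  | metric (p : Sym2 (Fin 4))
  | auxB (ρ : Fin 4)
  | gauge (a : ι) (μ : Fin 4)
  | auxb (a : ι)
  | matter (i : I₀)

/-- Components of the odd fields: graviton-ghost `C^ρ`, graviton-antighost `C̄^ρ`, gauge ghost `c^a`,
gauge antighost `c̄^a`, other odd fields. -/
inductive OddField (ι I₁ : Type*)
  | ghostC (ρ : Fin 4)
  | antighostC (ρ : Fin 4)
  | ghostc (a : ι)
  | antighostc (a : ι)
  | matter (i : I₁)

/-- A multi-index `J`, standing for the iterated derivative `∂^J`. -/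
abbrev MultiIndex : Type := Fin 4 → ℕ

/-- Jet coordinates `∂^J u` of the even fields. -/
abbrev EvenJet (ι I₀ : Type*) := EvenField ι I₀ × MultiIndex

/-- Jet coordinates `∂^J θ` of the odd fields. -/
abbrev OddJet (ι I₁ : Type*) := OddField ι I₁ × MultiIndex

/-! ### The even part of the algebra of local functions

Polynomials in the even jet coordinates and in one more variable `w = 1 / √(-det g)`, that is, modulo
the single relation `w² det g = -1`.  Both `√(-det g)` and the inverse metric live in this ring. -/

/-- Polynomials in the even jet coordinates (`some z`) and in `w` (`none`). -/
abbrev PreEven (ι I₀ : Type*) := MvPolynomial (Option (EvenJet ι I₀)) ℝ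

/-- The polynomial `det g`. -/
def preDet (ι I₀ : Type*) : PreEven ι I₀ :=
  (Matrix.of fun μ ν : Fin 4 =>
    (MvPolynomial.X (some (EvenField.metric s(μ, ν), 0)) : PreEven ι I₀)).det

/-- The ideal of the relation `w² det g + 1 = 0`. -/
def volumeIdeal (ι I₀ : Type*) : Ideal (PreEven ι I₀) :=
  Ideal.span {MvPolynomial.X none ^ 2 * preDet ι I₀ + 1}

/-- The commutative ring of local functions of the even fields. -/
def EvenAlg (ι I₀ : Type*) := PreEven ι I₀ ⧸ volumeIdeal ι I₀

instance (ι I₀ : Type*) : CommRing (EvenAlg ι I₀) :=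
  inferInstanceAs (CommRing (PreEven ι I₀ ⧸ volumeIdeal ι I₀))

instance (ι I₀ : Type*) : Algebra ℝ (EvenAlg ι I₀) :=
  inferInstanceAs (Algebra ℝ (PreEven ι I₀ ⧸ volumeIdeal ι I₀))

/-- The projection from the polynomials. -/
def toEvenAlg (ι I₀ : Type*) : PreEven ι I₀ →ₐ[ℝ] EvenAlg ι I₀ :=
  Ideal.Quotient.mkₐ ℝ (volumeIdeal ι I₀)

lemma toEvenAlg_surjective (ι I₀ : Type*) : Function.Surjective (toEvenAlg ι I₀) :=
  Ideal.Quotient.mkₐ_surjective ℝ _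

lemma toEvenAlg_eq_zero_iff {ι I₀ : Type*} (x : PreEven ι I₀) :
    toEvenAlg ι I₀ x = 0 ↔ x ∈ volumeIdeal ι I₀ :=
  Ideal.Quotient.eq_zero_iff_mem

/-- The derivative with respect to the jet coordinate `z` before passing to the quotient: by the chain
rule, `∂w/∂z = ½ w³ ∂(det g)/∂z`. -/
def preEvenPartial {ι I₀ : Type*} (z : EvenJet ι I₀) :
    Derivation ℝ (PreEven ι I₀) (PreEven ι I₀) :=
  MvPolynomial.pderiv (some z) +
    (MvPolynomial.C (1 / 2) * MvPolynomial.X none ^ 3 *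
      MvPolynomial.pderiv (some z) (preDet ι I₀)) • MvPolynomial.pderiv none

lemma pderiv_none_preDet (ι I₀ : Type*) :
    MvPolynomial.pderiv none (preDet ι I₀) = 0 := by
  classical
  unfold preDet
  rw [Matrix.det_apply, map_sum]
  refine Finset.sum_eq_zero fun σ _ => ?_
  rw [Units.smul_def, map_zsmul]
  simp [Fin.prod_univ_four, Derivation.leibniz, MvPolynomial.pderiv_X]

lemma preEvenPartial_mem {ι I₀ : Type*} (z : EvenJet ι I₀) (x : PreEven ι I₀)
    (hx : toEvenAlg ι I₀ x = 0) : toEvenAlg ι I₀ (preEvenPartial z x) = 0 := by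
  classical
  have key : preEvenPartial z (MvPolynomial.X none ^ 2 * preDet ι I₀ + 1) =
      (MvPolynomial.X none ^ 2 * preDet ι I₀ + 1) *
        (MvPolynomial.X none ^ 2 * MvPolynomial.pderiv (some z) (preDet ι I₀)) := by
    have h2 : (MvPolynomial.C (1 / 2) : PreEven ι I₀) * 2 = 1 := by
      rw [show (2 : PreEven ι I₀) = MvPolynomial.C 2 from (map_ofNat MvPolynomial.C 2).symm,
        ← MvPolynomial.C_mul]
      norm_num
    simp only [preEvenPartial, map_add, Derivation.add_apply, Derivation.smul_apply,
      Derivation.leibniz, Derivation.leibniz_pow, pderiv_none_preDet, MvPolynomial.pderiv_X,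
      Derivation.map_one_eq_zero, smul_eq_mul, nsmul_eq_mul]
    simp only [Pi.single_apply]
    simp only [reduceCtorEq, if_false, if_true]
    linear_combination (preDet ι I₀ * MvPolynomial.pderiv (some z) (preDet ι I₀) *
      MvPolynomial.X none ^ 4) * h2
  rw [toEvenAlg_eq_zero_iff, volumeIdeal, Ideal.mem_span_singleton'] at *
  obtain ⟨a, rfl⟩ := hx
  rw [Derivation.leibniz, key, smul_eq_mul, smul_eq_mul]
  exact ⟨a * (MvPolynomial.X none ^ 2 * MvPolynomial.pderiv (some z) (preDet ι I₀)) +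
    preEvenPartial z a, by ring⟩

/-- The partial derivative `∂/∂z` on local functions of the even fields. -/
def evenAlgPartial {ι I₀ : Type*} (z : EvenJet ι I₀) :
    Derivation ℝ (EvenAlg ι I₀) (EvenAlg ι I₀) :=
  Derivation.liftOfSurjective (toEvenAlg_surjective ι I₀) (d := preEvenPartial z)
    (preEvenPartial_mem z)

/-- The metric as a matrix over the ring of even local functions. -/
def metricMatrix (ι I₀ : Type*) : Matrix (Fin 4) (Fin 4) (EvenAlg ι I₀) :=
  Matrix.of fun μ ν => toEvenAlg ι I₀ (MvPolynomial.X (some (EvenField.metric s(μ, ν), 0)))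

/-- `√(-det g) = -w det g`. -/
def sqrtNegDet (ι I₀ : Type*) : EvenAlg ι I₀ :=
  -(toEvenAlg ι I₀ (MvPolynomial.X none) * (metricMatrix ι I₀).det)

lemma det_metricMatrix (ι I₀ : Type*) :
    toEvenAlg ι I₀ (MvPolynomial.X none) ^ 2 * (metricMatrix ι I₀).det
      = -1 := by
  have h : (metricMatrix ι I₀).det = toEvenAlg ι I₀ (preDet ι I₀) := by
    rw [preDet, AlgHom.map_det]; rfl
  have h' : toEvenAlg ι I₀ (MvPolynomial.X none ^ 2 * preDet ι I₀ + 1) = 0 :=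
    (toEvenAlg_eq_zero_iff _).2 (Ideal.subset_span rfl)
  rw [h, ← map_pow, ← map_mul, eq_neg_iff_add_eq_zero, ← map_one (toEvenAlg ι I₀), ← map_add,
    h']

/-- The metric is invertible, so `(metricMatrix ι I₀)⁻¹` is the true inverse metric. -/
lemma isUnit_det_metricMatrix (ι I₀ : Type*) : IsUnit (metricMatrix ι I₀).det :=
  IsUnit.of_mul_eq_one (-(toEvenAlg ι I₀ (MvPolynomial.X none) ^ 2)) (by
    linear_combination -det_metricMatrix ι I₀)

lemma sqrtNegDet_sq (ι I₀ : Type*) : sqrtNegDet ι I₀ ^ 2 = -(metricMatrix ι I₀).det := by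
  unfold sqrtNegDet
  linear_combination (metricMatrix ι I₀).det * det_metricMatrix ι I₀

/-! ### The superalgebra of local functions and its vector fields -/

/-- Local functions: the even ones tensored with the Grassmann algebra on the odd jet coordinates.
Odd coordinates of all kinds anticommute with each other. -/
def LocalAlg (ι I₀ I₁ : Type*) := EvenAlg ι I₀ ⊗[ℝ] ExteriorAlgebra ℝ (OddJet ι I₁ →₀ ℝ)

instance (ι I₀ I₁ : Type*) : Ring (LocalAlg ι I₀ I₁) :=
  inferInstanceAs (Ring (EvenAlg ι I₀ ⊗[ℝ] ExteriorAlgebra ℝ (OddJet ι I₁ →₀ ℝ)))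

instance (ι I₀ I₁ : Type*) : Algebra ℝ (LocalAlg ι I₀ I₁) :=
  inferInstanceAs (Algebra ℝ (EvenAlg ι I₀ ⊗[ℝ] ExteriorAlgebra ℝ (OddJet ι I₁ →₀ ℝ)))

section Fields

variable {ι I₀ I₁ : Type*}

/-- The inclusion of the even local functions. -/
def ofEven : EvenAlg ι I₀ →ₐ[ℝ] LocalAlg ι I₀ I₁ :=
  (Algebra.TensorProduct.includeLeft :
    EvenAlg ι I₀ →ₐ[ℝ] EvenAlg ι I₀ ⊗[ℝ] ExteriorAlgebra ℝ (OddJet ι I₁ →₀ ℝ))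

/-- The inclusion of the Grassmann algebra. -/
def ofOdd : ExteriorAlgebra ℝ (OddJet ι I₁ →₀ ℝ) →ₐ[ℝ] LocalAlg ι I₀ I₁ :=
  (Algebra.TensorProduct.includeRight : ExteriorAlgebra ℝ (OddJet ι I₁ →₀ ℝ) →ₐ[ℝ]
    EvenAlg ι I₀ ⊗[ℝ] ExteriorAlgebra ℝ (OddJet ι I₁ →₀ ℝ))

/-- The jet coordinate `∂^J u` of an even field. -/
def evenCoord (z : EvenJet ι I₀) : LocalAlg ι I₀ I₁ :=
  ofEven (toEvenAlg ι I₀ (MvPolynomial.X (some z)))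

/-- The jet coordinate `∂^J θ` of an odd field. -/
def oddCoord (z : OddJet ι I₁) : LocalAlg ι I₀ I₁ :=
  ofOdd (ExteriorAlgebra.ι ℝ (Finsupp.single z 1))

/-- `∂/∂z` for an even jet coordinate. -/
def evenPartial (z : EvenJet ι I₀) : LocalAlg ι I₀ I₁ →ₗ[ℝ] LocalAlg ι I₀ I₁ :=
  TensorProduct.map (evenAlgPartial z : EvenAlg ι I₀ →ₗ[ℝ] EvenAlg ι I₀) LinearMap.id

/-- The left derivative `∂/∂z` for an odd jet coordinate. -/
def oddPartial (z : OddJet ι I₁) : LocalAlg ι I₀ I₁ →ₗ[ℝ] LocalAlg ι I₀ I₁ :=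
  TensorProduct.map LinearMap.id (CliffordAlgebra.contractLeft (Finsupp.lapply z))

/-- The vector field `∑_z V_z ∂/∂z + ∑_z W_z ∂/∂z` with the sums running over the even and over the
odd jet coordinates.  Every local function involves finitely many coordinates, so on each of them
the sums are finite. -/
def vectorField (V : EvenJet ι I₀ → LocalAlg ι I₀ I₁) (W : OddJet ι I₁ → LocalAlg ι I₀ I₁)
    (X : LocalAlg ι I₀ I₁) : LocalAlg ι I₀ I₁ :=
  (∑ᶠ z, V z * evenPartial z X) + ∑ᶠ z, W z * oddPartial z X

/-- The total derivative `∂_μ`. -/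
def totalD (μ : Fin 4) : LocalAlg ι I₀ I₁ → LocalAlg ι I₀ I₁ :=
  vectorField (fun z => evenCoord (z.1, z.2 + Pi.single μ 1))
    (fun z => oddCoord (z.1, z.2 + Pi.single μ 1))

/-- The iterated total derivative `∂^J`. -/
def iterD (J : MultiIndex) (X : LocalAlg ι I₀ I₁) : LocalAlg ι I₀ I₁ :=
  (totalD 0)^[J 0] ((totalD 1)^[J 1] ((totalD 2)^[J 2] ((totalD 3)^[J 3] X)))

/-- The vector field on the jets with prescribed values `p u` and `q θ` on the fields, prolonged by
`∂^J u ↦ ∂^J (p u)` and `∂^J θ ↦ ∂^J (q θ)`. -/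
def prolong (p : EvenField ι I₀ → LocalAlg ι I₀ I₁) (q : OddField ι I₁ → LocalAlg ι I₀ I₁) :
    LocalAlg ι I₀ I₁ → LocalAlg ι I₀ I₁ :=
  vectorField (fun z => iterD z.2 (p z.1)) (fun z => iterD z.2 (q z.1))

/-- Equality of Lagrange densities modulo total derivatives.  A density is represented by its
coefficient with respect to `dt ∧ dx ∧ dy ∧ dz`. -/
def EqModTD (X Y : LocalAlg ι I₀ I₁) : Prop :=
  ∃ J : Fin 4 → LocalAlg ι I₀ I₁, X - Y = ∑ μ, totalD μ (J μ)

/-! ### The fields as local functions -/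

/-- The metric `g_{μν}`. -/
def met (μ ν : Fin 4) : LocalAlg ι I₀ I₁ := evenCoord (.metric s(μ, ν), 0)

/-- The inverse metric `g^{μν}`. -/
def metInv (μ ν : Fin 4) : LocalAlg ι I₀ I₁ := ofEven ((metricMatrix ι I₀)⁻¹ μ ν)

/-- The coefficient `√(-det g)` of the Riemannian volume form `dV_g`. -/
def volg : LocalAlg ι I₀ I₁ := ofEven (sqrtNegDet ι I₀)

def fieldB (ρ : Fin 4) : LocalAlg ι I₀ I₁ := evenCoord (.auxB ρ, 0)

def fieldA (a : ι) (μ : Fin 4) : LocalAlg ι I₀ I₁ := evenCoord (.gauge a μ, 0)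

def fieldb (a : ι) : LocalAlg ι I₀ I₁ := evenCoord (.auxb a, 0)

def fieldC (ρ : Fin 4) : LocalAlg ι I₀ I₁ := oddCoord (.ghostC ρ, 0)

def fieldCbar (ρ : Fin 4) : LocalAlg ι I₀ I₁ := oddCoord (.antighostC ρ, 0)

def fieldc (a : ι) : LocalAlg ι I₀ I₁ := oddCoord (.ghostc a, 0)

def fieldcbar (a : ι) : LocalAlg ι I₀ I₁ := oddCoord (.antighostc a, 0)

def evenMatter (i : I₀) : LocalAlg ι I₀ I₁ := evenCoord (.matter i, 0)

def oddMatter (i : I₁) : LocalAlg ι I₀ I₁ := oddCoord (.matter i, 0)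

/-- The Minkowski metric `η = diag(1, -1, -1, -1)`, equal to its inverse. -/
def eta (μ ν : Fin 4) : ℝ := if μ = ν then (if μ = 0 then 1 else -1) else 0

/-- The graviton field `h_{μν}` of the decomposition `g_{μν} = η_{μν} + α h_{μν}`.  Since
`P g_{μν} = ϰ (∇_μ C_ν + ∇_ν C_μ)`, one has `P h_{μν} = (ϰ/α) (∇_μ C_ν + ∇_ν C_μ)`; the choice `α = ϰ`
is the usual decomposition and `α = ϰ ζ` gives `P h_{μν} = (1/ζ) (∇_μ C_ν + ∇_ν C_μ)`. -/
def graviton (α : ℝ) (μ ν : Fin 4) : LocalAlg ι I₀ I₁ :=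
  (1 / α) • (met μ ν - algebraMap ℝ _ (eta μ ν))

/-! ### Lie derivatives with respect to an (odd) vector field `K^ρ` on spacetime -/

/-- `£_K` of a scalar. -/
def lieScalar (K : Fin 4 → LocalAlg ι I₀ I₁) (φ : LocalAlg ι I₀ I₁) : LocalAlg ι I₀ I₁ :=
  ∑ ρ, K ρ * totalD ρ φ

/-- `£_K` of a covector. -/
def lieCovector (K : Fin 4 → LocalAlg ι I₀ I₁) (A : Fin 4 → LocalAlg ι I₀ I₁) (μ : Fin 4) :
    LocalAlg ι I₀ I₁ :=
  ∑ ρ, (K ρ * totalD ρ (A μ) + totalD μ (K ρ) * A ρ)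

/-- `(£_K g)_{μν} = K^ρ ∂_ρ g_{μν} + (∂_μ K^ρ) g_{ρν} + (∂_ν K^ρ) g_{μρ}`, the coordinate form of
`∇_μ K_ν + ∇_ν K_μ`. -/
def lieMetric (K : Fin 4 → LocalAlg ι I₀ I₁) (μ ν : Fin 4) : LocalAlg ι I₀ I₁ :=
  ∑ ρ, (K ρ * totalD ρ (met μ ν) + totalD μ (K ρ) * met ρ ν + totalD ν (K ρ) * met μ ρ)

lemma lieMetric_comm (K : Fin 4 → LocalAlg ι I₀ I₁) (μ ν : Fin 4) :
    lieMetric K μ ν = lieMetric K ν μ := by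
  have h : ∀ μ ν : Fin 4, (met μ ν : LocalAlg ι I₀ I₁) = met ν μ := fun μ ν => by
    simp [met, Sym2.eq_swap]
  unfold lieMetric
  refine Finset.sum_congr rfl fun ρ _ => ?_
  rw [h μ ν, h ρ ν, h μ ρ, add_right_comm]

/-- `£_K g` as a function of the unordered pair of indices. -/
def lieMetricSym (K : Fin 4 → LocalAlg ι I₀ I₁) (p : Sym2 (Fin 4)) : LocalAlg ι I₀ I₁ :=
  Sym2.lift ⟨lieMetric K, lieMetric_comm K⟩ p

end Fields

/-- The way in which the components `φ^i` of the other particle fields transform: a representation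
of `gl(4)`, which says what kind of tensor (density) they form, and a commuting representation of the
gauge Lie algebra. -/
structure Multiplet (𝔤 I : Type*) [LieRing 𝔤] [LieAlgebra ℝ 𝔤] [Fintype I] where
  tensor : Matrix (Fin 4) (Fin 4) ℝ →ₗ[ℝ] Matrix I I ℝ
  tensor_lie : ∀ X Y, tensor (X * Y - Y * X) = tensor X * tensor Y - tensor Y * tensor X
  charge : 𝔤 →ₗ[ℝ] Matrix I I ℝ
  charge_lie : ∀ x y, charge ⁅x, y⁆ = charge x * charge y - charge y * charge x
  comm : ∀ X y, Commute (tensor X) (charge y)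

section Operators

variable {𝔤 ι I₀ I₁ : Type*} [LieRing 𝔤] [LieAlgebra ℝ 𝔤]
  [Fintype ι] [Fintype I₀] [Fintype I₁]

/-- `(£_K φ)^i = K^ρ ∂_ρ φ^i - (∂_ν K^μ) (E_{μν})^i_j φ^j`, where `E_{μν}` is the elementary matrix;
for vectors (`tensor X = X`) and covectors (`tensor X = -Xᵀ`) these are the usual formulas. -/
def lieMatter {I : Type*} [Fintype I] (M : Multiplet 𝔤 I)
    (K : Fin 4 → LocalAlg ι I₀ I₁) (φ : I → LocalAlg ι I₀ I₁) (i : I) : LocalAlg ι I₀ I₁ :=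
  lieScalar K (φ i) -
    ∑ μ, ∑ ν, ∑ j, M.tensor (Matrix.single μ ν 1) i j • (totalD ν (K μ) * φ j)

/-- `(ℓ_k φ)^i = k^a (e_a)^i_j φ^j`, the infinitesimal gauge transformation. -/
def gaugeMatter {I : Type*} [Fintype I] (M : Multiplet 𝔤 I)
    (e : Module.Basis ι ℝ 𝔤) (k : ι → LocalAlg ι I₀ I₁) (φ : I → LocalAlg ι I₀ I₁) (i : I) :
    LocalAlg ι I₀ I₁ :=
  ∑ a, ∑ j, M.charge (e a) i j • (k a * φ j)

/-- The structure constants: `[e_b, e_c] = f^a_{bc} e_a`. -/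
def structConst (e : Module.Basis ι ℝ 𝔤) (a b c : ι) : ℝ := e.repr ⁅e b, e c⁆ a

/-- `f^a_{bc} x^b y^c`. -/
def colorBracket (e : Module.Basis ι ℝ 𝔤) (x y : ι → LocalAlg ι I₀ I₁) (a : ι) :
    LocalAlg ι I₀ I₁ :=
  ∑ b, ∑ c, structConst e a b c • (x b * y c)

/-- The diffeomorphism BRST operator `P`. -/
def opP (ϰ ζ : ℝ) (M₀ : Multiplet 𝔤 I₀) (M₁ : Multiplet 𝔤 I₁) :
    LocalAlg ι I₀ I₁ → LocalAlg ι I₀ I₁ :=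
  prolong
    (fun u => match u with
      | .metric p => ϰ • lieMetricSym fieldC p
      | .auxB _ => 0
      | .gauge a μ => ϰ • lieCovector fieldC (fieldA a) μ
      | .auxb a => ϰ • lieScalar fieldC (fieldb a)
      | .matter i => ϰ • lieMatter M₀ fieldC evenMatter i)
    (fun θ => match θ with
      | .ghostC ρ => ϰ • ∑ σ, fieldC σ * totalD σ (fieldC ρ)
      | .antighostC ρ => (1 / ζ) • fieldB ρ
      | .ghostc a => ϰ • lieScalar fieldC (fieldc a)
      | .antighostc a => ϰ • lieScalar fieldC (fieldcbar a)
      | .matter i => ϰ • lieMatter M₁ fieldC oddMatter i)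

/-- The diffeomorphism anti-BRST operator `P̄`. -/
def opPbar (ϰ ζ : ℝ) (M₀ : Multiplet 𝔤 I₀) (M₁ : Multiplet 𝔤 I₁) :
    LocalAlg ι I₀ I₁ → LocalAlg ι I₀ I₁ :=
  prolong
    (fun u => match u with
      | .metric p => ϰ • lieMetricSym fieldCbar p
      | .auxB ρ => ϰ • ∑ σ, (fieldCbar σ * totalD σ (fieldB ρ) -
          totalD σ (fieldCbar ρ) * fieldB σ)
      | .gauge a μ => ϰ • lieCovector fieldCbar (fieldA a) μ
      | .auxb a => ϰ • lieScalar fieldCbar (fieldb a)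
      | .matter i => ϰ • lieMatter M₀ fieldCbar evenMatter i)
    (fun θ => match θ with
      | .ghostC ρ => -((1 / ζ) • fieldB ρ) +
          ϰ • ∑ σ, (fieldCbar σ * totalD σ (fieldC ρ) - totalD σ (fieldCbar ρ) * fieldC σ)
      | .antighostC ρ => ϰ • ∑ σ, fieldCbar σ * totalD σ (fieldCbar ρ)
      | .ghostc a => ϰ • lieScalar fieldCbar (fieldc a)
      | .antighostc a => ϰ • lieScalar fieldCbar (fieldcbar a)
      | .matter i => ϰ • lieMatter M₁ fieldCbar oddMatter i)

/-- The gauge BRST operator `Q`; `γ` is the gauge coupling constant.  The gravitational fields are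
gauge singlets. -/
def opQ (γ ξ : ℝ) (e : Module.Basis ι ℝ 𝔤) (M₀ : Multiplet 𝔤 I₀) (M₁ : Multiplet 𝔤 I₁) :
    LocalAlg ι I₀ I₁ → LocalAlg ι I₀ I₁ :=
  prolong
    (fun u => match u with
      | .metric _ => 0
      | .auxB _ => 0
      | .gauge a μ => (1 / ξ) • totalD μ (fieldc a) +
          γ • colorBracket e fieldc (fun c => fieldA c μ) a
      | .auxb _ => 0
      | .matter i => γ • gaugeMatter M₀ e fieldc evenMatter i)
    (fun θ => match θ with
      | .ghostC _ => 0
      | .antighostC _ => 0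
      | .ghostc a => (γ / 2) • colorBracket e fieldc fieldc a
      | .antighostc a => (1 / ξ) • fieldb a
      | .matter i => γ • gaugeMatter M₁ e fieldc oddMatter i)

/-- The gauge anti-BRST operator `Q̄`. -/
def opQbar (γ ξ : ℝ) (e : Module.Basis ι ℝ 𝔤) (M₀ : Multiplet 𝔤 I₀) (M₁ : Multiplet 𝔤 I₁) :
    LocalAlg ι I₀ I₁ → LocalAlg ι I₀ I₁ :=
  prolong
    (fun u => match u with
      | .metric _ => 0
      | .auxB _ => 0
      | .gauge a μ => (1 / ξ) • totalD μ (fieldcbar a) +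
          γ • colorBracket e fieldcbar (fun c => fieldA c μ) a
      | .auxb a => γ • colorBracket e fieldcbar fieldb a
      | .matter i => γ • gaugeMatter M₀ e fieldcbar evenMatter i)
    (fun θ => match θ with
      | .ghostC _ => 0
      | .antighostC _ => 0
      | .ghostc a => -((1 / ξ) • fieldb a) + γ • colorBracket e fieldcbar fieldc a
      | .antighostc a => (γ / 2) • colorBracket e fieldcbar fieldcbar a
      | .matter i => γ • gaugeMatter M₁ e fieldcbar oddMatter i)

/-- The total BRST operator `D = P + Q`. -/
def opD (ϰ ζ γ ξ : ℝ) (e : Module.Basis ι ℝ 𝔤) (M₀ : Multiplet 𝔤 I₀) (M₁ : Multiplet 𝔤 I₁) :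
    LocalAlg ι I₀ I₁ → LocalAlg ι I₀ I₁ :=
  opP ϰ ζ M₀ M₁ + opQ γ ξ e M₀ M₁

/-- The total anti-BRST operator `D̄ = P̄ + Q̄`. -/
def opDbar (ϰ ζ γ ξ : ℝ) (e : Module.Basis ι ℝ 𝔤) (M₀ : Multiplet 𝔤 I₀) (M₁ : Multiplet 𝔤 I₁) :
    LocalAlg ι I₀ I₁ → LocalAlg ι I₀ I₁ :=
  opPbar ϰ ζ M₀ M₁ + opQbar γ ξ e M₀ M₁

/-- The diffeomorphism super-BRST operator `P ∘ P̄`. -/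
def superP (ϰ ζ : ℝ) (M₀ : Multiplet 𝔤 I₀) (M₁ : Multiplet 𝔤 I₁) :
    LocalAlg ι I₀ I₁ → LocalAlg ι I₀ I₁ :=
  opP ϰ ζ M₀ M₁ ∘ opPbar ϰ ζ M₀ M₁

/-- The gauge super-BRST operator `Q ∘ Q̄`. -/
def superQ (γ ξ : ℝ) (e : Module.Basis ι ℝ 𝔤) (M₀ : Multiplet 𝔤 I₀) (M₁ : Multiplet 𝔤 I₁) :
    LocalAlg ι I₀ I₁ → LocalAlg ι I₀ I₁ :=
  opQ γ ξ e M₀ M₁ ∘ opQbar γ ξ e M₀ M₁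

/-- The total super-BRST operator `D ∘ D̄`. -/
def superD (ϰ ζ γ ξ : ℝ) (e : Module.Basis ι ℝ 𝔤) (M₀ : Multiplet 𝔤 I₀) (M₁ : Multiplet 𝔤 I₁) :
    LocalAlg ι I₀ I₁ → LocalAlg ι I₀ I₁ :=
  opD ϰ ζ γ ξ e M₀ M₁ ∘ opDbar ϰ ζ γ ξ e M₀ M₁

/-- The gravitational gauge fixing boson
`F = -ζ/4 ((1/ϰ) η^{μν} h_{μν} - C̄^ρ C_ρ) dV_η`, with `C_ρ = η_{ρσ} C^σ`. -/
def bosonF (ϰ ζ α : ℝ) : LocalAlg ι I₀ I₁ :=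
  (-(ζ / 4)) • ((1 / ϰ) • ∑ μ, ∑ ν, eta μ ν • graviton α μ ν -
    ∑ ρ, fieldCbar ρ * ∑ σ, eta ρ σ • fieldC σ)

/-- The Yang–Mills gauge fixing boson `G = -ξ/2 (δ_{ab} g^{μν} A^a_μ A^b_ν - c̄_a c^a) dV_g`. -/
def bosonG (ξ : ℝ) : LocalAlg ι I₀ I₁ :=
  (-(ξ / 2)) • ((∑ a, ∑ μ, ∑ ν, metInv μ ν * fieldA a μ * fieldA a ν -
    ∑ a, fieldcbar a * fieldc a) * volg)

/-- The total gauge fixing boson `B = F + G`. -/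
def bosonB (ϰ ζ ξ α : ℝ) : LocalAlg ι I₀ I₁ := bosonF ϰ ζ α + bosonG ξ

/-- The gauge fixing and ghost Lagrange density of gravity. -/
def grGFGhost (ϰ ζ α : ℝ) (M₀ : Multiplet 𝔤 I₀) (M₁ : Multiplet 𝔤 I₁) : LocalAlg ι I₀ I₁ :=
  superP ϰ ζ M₀ M₁ (bosonF ϰ ζ α)

/-- The gauge fixing and ghost Lagrange density of Yang–Mills theory. -/
def ymGFGhost (γ ξ : ℝ) (e : Module.Basis ι ℝ 𝔤) (M₀ : Multiplet 𝔤 I₀) (M₁ : Multiplet 𝔤 I₁) :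
    LocalAlg ι I₀ I₁ :=
  superQ γ ξ e M₀ M₁ (bosonG ξ)

end Operators

end

end BRST

/-!
The operators `P` and `P̄` act on every tensor built from the metric and the gauge sector as
Lie derivatives along `ϰ C` and `ϰ C̄`, hence on a scalar times `dV_g` as a total derivative.
The gauge fixing boson `G` is such a density, so `P̄ G` is a total derivative. As `Q̄`
annihilates the metric and maps covectors and scalars of the gauge sector to covectors and
scalars, `Q̄ G` is again a scalar times `dV_g`, so `P (Q̄ G)` is a total derivative, too.
Conversely `Q` and `Q̄` annihilate the gravitational fields, whence `Q̄ F = 0` and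
`Q (P̄ F) = 0`. Expanding `D (D̄ (F + G))`, all that remains besides `P (P̄ F) + Q (Q̄ G)` is
`P (P̄ G) + Q (P̄ G) + P (Q̄ G)`, which is a total derivative since `P` and `Q` commute with the
total derivatives.

To read off tensor laws without the second derivatives of a Lie derivative, the transport term
`K^ρ ∂_ρ` is subtracted: `R - K^ρ ∂_ρ` is an odd derivation which kills scalars and acts on
covectors by the matrix `∂_μ K^ρ`, so products and contractions are handled by linear algebra
over it, and `dV_g` by Jacobi's formula for the determinant.
-/

namespace BRST

section TwistedDerivations

open scoped Matrix

variable {R A : Type*} [CommRing R] [Ring A] [Algebra R A] {σ τ : A →ₐ[R] A}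

/-- The elements of `A` which `V` passes at the cost of the endomorphism `σ`. -/
def twistedCommutant (σ : A →ₐ[R] A) (V : A) : Subalgebra R A where
  carrier := {X | V * X = σ X * V}
  add_mem' {X Y} (hX : V * X = σ X * V) (hY : V * Y = σ Y * V) := by
    change V * (X + Y) = σ (X + Y) * V
    rw [mul_add, hX, hY, map_add, add_mul]
  mul_mem' {X Y} (hX : V * X = σ X * V) (hY : V * Y = σ Y * V) := by
    change V * (X * Y) = σ (X * Y) * V
    rw [← mul_assoc, hX, mul_assoc, hY, map_mul, mul_assoc]
  algebraMap_mem' r := by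
    change V * algebraMap R A r = σ (algebraMap R A r) * V
    rw [AlgHom.commutes, Algebra.commutes]

/-- The elements which pass all others at the cost of `σ`.  If `σ` is the grade involution of a
superalgebra, odd elements have this property; for `σ = 1` this is the center. -/
def twistedCenter (σ : A →ₐ[R] A) : Submodule R A where
  carrier := {V | ∀ X, V * X = σ X * V}
  add_mem' {V W} (hV : ∀ X, V * X = σ X * V) (hW : ∀ X, W * X = σ X * W) X := by
    rw [add_mul, hV, hW, mul_add]
  zero_mem' X := by rw [zero_mul, mul_zero]
  smul_mem' r V (hV : ∀ X, V * X = σ X * V) X := by rw [smul_mul_assoc, hV, mul_smul_comm]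

lemma mul_mem_twistedCenter {V W : A} (hV : V ∈ twistedCenter σ) (hW : W ∈ twistedCenter τ) :
    V * W ∈ twistedCenter (σ * τ) := fun X => by
  rw [mul_assoc, hW, ← mul_assoc, hV, AlgHom.mul_apply, mul_assoc]

/-- Derivations which pick up the endomorphism `σ` when they pass a factor: derivations for
`σ = 1`, and odd derivations acting from the left if `σ` is the grade involution. -/
structure IsTwistedDer (σ : A →ₐ[R] A) (d : A → A) : Prop extends IsLinearMap R d where
  leibniz : ∀ X Y, d (X * Y) = d X * Y + σ X * d Y

namespace IsTwistedDer

variable {d d' : A → A}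

lemma map_sum (h : IsTwistedDer σ d) {κ : Type*} (s : Finset κ) (f : κ → A) :
    d (∑ i ∈ s, f i) = ∑ i ∈ s, d (f i) := _root_.map_sum (h.toIsLinearMap.mk' d) f s

lemma map_one (h : IsTwistedDer σ d) : d 1 = 0 := by
  have h1 := h.leibniz 1 1
  rwa [mul_one, mul_one, _root_.map_one, one_mul, left_eq_add] at h1

lemma add (h : IsTwistedDer σ d) (h' : IsTwistedDer σ d') :
    IsTwistedDer σ (fun X => d X + d' X) where
  map_add X Y := by rw [h.map_add, h'.map_add, add_add_add_comm]
  map_smul r X := by rw [h.map_smul, h'.map_smul, smul_add]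
  leibniz X Y := by rw [h.leibniz, h'.leibniz]; noncomm_ring

lemma sub (h : IsTwistedDer σ d) (h' : IsTwistedDer σ d') :
    IsTwistedDer σ (fun X => d X - d' X) where
  map_add X Y := by rw [h.map_add, h'.map_add, add_sub_add_comm]
  map_smul r X := by rw [h.map_smul, h'.map_smul, smul_sub]
  leibniz X Y := by rw [h.leibniz, h'.leibniz]; noncomm_ring

lemma commutator {D : A → A} (h : IsTwistedDer σ d) (hD : IsTwistedDer (1 : A →ₐ[R] A) D)
    (hσ : ∀ X, σ (D X) = D (σ X)) : IsTwistedDer σ (fun X => d (D X) - D (d X)) where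
  map_add X Y := by simp only [h.map_add, hD.map_add]; abel
  map_smul r X := by simp only [h.map_smul, hD.map_smul, smul_sub]
  leibniz X Y := by
    simp only [h.leibniz, hD.leibniz, h.map_add, hD.map_add, AlgHom.one_apply, hσ]
    noncomm_ring

lemma conj (h : IsTwistedDer σ d) (hτ : ∀ X, τ (τ X) = X) (hστ : ∀ X, τ (σ (τ X)) = σ X) :
    IsTwistedDer σ (fun X => τ (d (τ X))) where
  map_add X Y := by simp only [_root_.map_add, h.map_add]
  map_smul r X := by simp only [_root_.map_smul, h.map_smul]
  leibniz X Y := by simp only [_root_.map_mul, _root_.map_add, h.leibniz, hτ, hστ]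

lemma mul_left (h : IsTwistedDer τ d) {V : A} (hV : V ∈ twistedCenter σ) :
    IsTwistedDer (σ * τ) (fun X => V * d X) where
  map_add X Y := by rw [h.map_add, mul_add]
  map_smul r X := by rw [h.map_smul, mul_smul_comm]
  leibniz X Y := by
    rw [h.leibniz, mul_add, ← mul_assoc, ← mul_assoc V (τ X), hV (τ X), mul_assoc (σ (τ X)),
      AlgHom.mul_apply]

lemma finsum {κ : Type*} {d : κ → A → A} (h : ∀ z, IsTwistedDer σ (d z))
    (hfin : ∀ X, {z | d z X ≠ 0}.Finite) : IsTwistedDer σ (fun X => ∑ᶠ z, d z X) where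
  map_add X Y := by simp only [(h _).map_add, finsum_add_distrib (hfin X) (hfin Y)]
  map_smul r X := by simp only [(h _).map_smul, smul_finsum' r (hfin X)]
  leibniz X Y := by
    have hXY : {z | d z X * Y ≠ 0}.Finite :=
      (hfin X).subset fun z hz hX => hz (by rw [hX, zero_mul])
    have hYX : {z | σ X * d z Y ≠ 0}.Finite :=
      (hfin Y).subset fun z hz hY => hz (by rw [hY, mul_zero])
    simp only [(h _).leibniz, finsum_add_distrib hXY hYX, finsum_mul' _ _ (hfin X),
      mul_finsum' _ _ (hfin Y)]

/-- The constants of a twisted derivation. -/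
def ker (h : IsTwistedDer σ d) : Subalgebra R A where
  carrier := {X | d X = 0}
  add_mem' {X Y} (hX : d X = 0) (hY : d Y = 0) := by
    change d (X + Y) = 0
    rw [h.map_add, hX, hY, add_zero]
  mul_mem' {X Y} (hX : d X = 0) (hY : d Y = 0) := by
    change d (X * Y) = 0
    rw [h.leibniz, hX, hY, zero_mul, mul_zero, add_zero]
  algebraMap_mem' r := by
    change d (algebraMap R A r) = 0
    rw [Algebra.algebraMap_eq_smul_one, h.map_smul, h.map_one, smul_zero]

/-- The elements of a `σ`-stable subalgebra `B` which `d` maps into `B`. -/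
def stablePart (h : IsTwistedDer σ d) (B : Subalgebra R A) (hB : ∀ X ∈ B, σ X ∈ B) :
    Subalgebra R A where
  carrier := {X | X ∈ B ∧ d X ∈ B}
  add_mem' hX hY := ⟨add_mem hX.1 hY.1, by rw [h.map_add]; exact add_mem hX.2 hY.2⟩
  mul_mem' hX hY := ⟨mul_mem hX.1 hY.1, by
    rw [h.leibniz]; exact add_mem (mul_mem hX.2 hY.1) (mul_mem (hB _ hX.1) hY.2)⟩
  algebraMap_mem' r := ⟨B.algebraMap_mem r, by
    rw [show d (algebraMap R A r) = 0 from h.ker.algebraMap_mem r]; exact B.zero_mem⟩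

/-- The elements on which only finitely many members of a family of twisted derivations are
nonzero. -/
def finiteSupport {κ : Type*} {d : κ → A → A} (h : ∀ z, IsTwistedDer σ (d z)) :
    Subalgebra R A where
  carrier := {X | {z | d z X ≠ 0}.Finite}
  add_mem' {X Y} hX hY := by
    refine (hX.union hY).subset fun z hz => not_and_or.1 fun hXY => hz ?_
    exact (h z).ker.add_mem hXY.1 hXY.2
  mul_mem' {X Y} hX hY := by
    refine (hX.union hY).subset fun z hz => not_and_or.1 fun hXY => hz ?_
    exact (h z).ker.mul_mem hXY.1 hXY.2
  algebraMap_mem' r := by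
    refine Set.finite_empty.subset fun z hz => hz ?_
    exact (h z).ker.algebraMap_mem r

section Matrices

variable {n : Type*} [Fintype n]

lemma map_matrix_mul (h : IsTwistedDer σ d) (M N : Matrix n n A) :
    (M * N).map d = M.map d * N + M.map σ * N.map d := by
  ext i j
  simp only [Matrix.map_apply, Matrix.mul_apply, Matrix.add_apply, h.map_sum, h.leibniz,
    Finset.sum_add_distrib]

lemma map_mulVec (h : IsTwistedDer σ d) (M : Matrix n n A) (X : n → A) :
    (fun i => d ((M *ᵥ X) i)) = M.map d *ᵥ X + M.map σ *ᵥ fun i => d (X i) := by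
  ext i
  simp only [Matrix.mulVec, dotProduct, Matrix.map_apply, Pi.add_apply, h.map_sum, h.leibniz,
    Finset.sum_add_distrib]

/-- The vectors which `d` transforms by the matrix `Λ`. -/
def covectors (h : IsTwistedDer σ d) (Λ : Matrix n n A) : Submodule R (n → A) where
  carrier := {X | ∀ μ, d (X μ) = (Λ *ᵥ X) μ}
  add_mem' {X Y} (hX : ∀ μ, d (X μ) = (Λ *ᵥ X) μ) (hY : ∀ μ, d (Y μ) = (Λ *ᵥ Y) μ) μ := by
    rw [Pi.add_apply, h.map_add, hX, hY, Matrix.mulVec_add, Pi.add_apply]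
  zero_mem' μ := by rw [Pi.zero_apply, h.map_zero, Matrix.mulVec_zero, Pi.zero_apply]
  smul_mem' r X (hX : ∀ μ, d (X μ) = (Λ *ᵥ X) μ) μ := by
    rw [Pi.smul_apply, h.map_smul, hX, Matrix.mulVec_smul, Pi.smul_apply]

lemma scalar_mul_mem_covectors (h : IsTwistedDer σ d) {Λ : Matrix n n A}
    (hΛ : ∀ μ ν, Λ μ ν ∈ twistedCenter σ) {s : A} (hs : s ∈ h.ker) {X : n → A}
    (hX : X ∈ h.covectors Λ) : (fun μ => s * X μ) ∈ h.covectors Λ := fun μ => by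
  rw [h.leibniz, show d s = 0 from hs, zero_mul, zero_add, hX]
  simp only [Matrix.mulVec, dotProduct, Finset.mul_sum]
  exact Finset.sum_congr rfl fun ν _ => by rw [← mul_assoc, ← mul_assoc, hΛ]

lemma dotProduct_mem_ker (h : IsTwistedDer σ d) {Λ : Matrix n n A}
    (hΛ : ∀ μ ν, Λ μ ν ∈ twistedCenter σ) {Z X : n → A} (hZ : Z ∈ h.covectors (-Λᵀ))
    (hX : X ∈ h.covectors Λ) : Z ⬝ᵥ X ∈ h.ker := by
  have hswap : ∑ μ, ∑ ν, Λ ν μ * Z ν * X μ = ∑ μ, ∑ ν, σ (Z μ) * (Λ μ ν * X ν) := by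
    rw [Finset.sum_comm]
    exact Finset.sum_congr rfl fun μ _ => Finset.sum_congr rfl fun ν _ => by
      rw [hΛ, mul_assoc]
  change d (∑ μ, Z μ * X μ) = 0
  simp only [h.map_sum, h.leibniz, hZ _, hX _, Finset.sum_add_distrib]
  simp only [Matrix.mulVec, dotProduct, Matrix.neg_apply, Matrix.transpose_apply, neg_mul,
    Finset.sum_neg_distrib, Finset.sum_mul, Finset.mul_sum, hswap, neg_add_cancel]

lemma map_inverse_matrix [DecidableEq n] (h : IsTwistedDer σ d) {Λ g g' : Matrix n n A}
    (hg : g.map d = Λ * g + g * Λᵀ) (hgg' : g * g' = 1) (hg'g : g' * g = 1)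
    (hσ : g'.map σ = g') : g'.map d = -(g' * Λ + Λᵀ * g') := by
  have hone : (1 : Matrix n n A).map d = 0 := by
    ext i j
    by_cases hij : i = j <;> simp [hij, h.map_one, h.map_zero]
  have hzero : g'.map d * g + g' * (Λ * g + g * Λᵀ) = 0 := by
    rw [← hg, ← hone, ← hg'g, h.map_matrix_mul, hσ]
  calc g'.map d = g'.map d * g * g' := by rw [mul_assoc, hgg', mul_one]
    _ = -(g' * (Λ * g + g * Λᵀ)) * g' := by rw [eq_neg_of_add_eq_zero_left hzero]
    _ = -(g' * Λ * (g * g') + g' * g * Λᵀ * g') := by noncomm_ring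
    _ = -(g' * Λ + Λᵀ * g') := by rw [hgg', hg'g, mul_one, one_mul]

lemma mulVec_mem_covectors (h : IsTwistedDer σ d) {Λ g' : Matrix n n A}
    (hg' : g'.map d = -(g' * Λ + Λᵀ * g')) (hσ : g'.map σ = g') {X : n → A}
    (hX : X ∈ h.covectors Λ) : g' *ᵥ X ∈ h.covectors (-Λᵀ) := fun μ => by
  have hdX : (fun ν => d (X ν)) = Λ *ᵥ X := funext hX
  rw [congrFun (h.map_mulVec g' X) μ, hdX, hg', hσ]
  simp only [Matrix.neg_mul, Matrix.neg_mulVec, Matrix.add_mulVec, Matrix.mulVec_mulVec,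
    Pi.add_apply, Pi.neg_apply]
  abel

end Matrices

end IsTwistedDer

lemma trace_mul_comm_of_commute {n : Type*} [Fintype n] {M N : Matrix n n A}
    (h : ∀ i j k l, Commute (M i j) (N k l)) : (M * N).trace = (N * M).trace := by
  simp only [Matrix.trace, Matrix.diag_apply, Matrix.mul_apply]
  rw [Finset.sum_comm]
  exact Finset.sum_congr rfl fun j _ => Finset.sum_congr rfl fun i _ => h i j j i

end TwistedDerivations

section Jacobi

variable {R A M n : Type*} [CommRing R] [CommRing A] [Algebra R A] [AddCommGroup M] [Module A M]
  [Module R M] [DecidableEq n]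

lemma derivation_prod (D : Derivation R A M) (s : Finset n) (f : n → A) :
    D (∏ i ∈ s, f i) = ∑ i ∈ s, (∏ k ∈ s.erase i, f k) • D (f i) := by
  induction s using Finset.induction_on with
  | empty => simp
  | insert a s ha ih =>
    rw [Finset.prod_insert ha, D.leibniz, ih, Finset.sum_insert ha, Finset.erase_insert ha,
      add_comm, Finset.smul_sum]
    congr 1
    refine Finset.sum_congr rfl fun i hi => ?_
    have hai : a ≠ i := fun hai => ha (hai ▸ hi)
    rw [Finset.erase_insert_of_ne hai, Finset.prod_insert (mt Finset.mem_of_mem_erase ha),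
      mul_smul]

variable [Fintype n]

lemma adjugate_apply_eq_sum_perm (g : Matrix n n A) (i j : n) :
    g.adjugate j i = ∑ π : Equiv.Perm n, if π i = j then
      (Equiv.Perm.sign π : ℤ) • ∏ k ∈ Finset.univ.erase i, g k (π k) else 0 := by
  rw [Matrix.adjugate_apply, ← Matrix.det_transpose, Matrix.det_apply]
  refine Finset.sum_congr rfl fun π _ => ?_
  have hprod : ∏ k ∈ Finset.univ.erase i, (g.updateRow i (Pi.single j 1)).transpose (π k) k
      = ∏ k ∈ Finset.univ.erase i, g k (π k) := Finset.prod_congr rfl fun k hk => by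
    rw [Matrix.transpose_apply, Matrix.updateRow_ne (Finset.ne_of_mem_erase hk)]
  rw [← Finset.mul_prod_erase _ _ (Finset.mem_univ i), hprod, Matrix.transpose_apply,
    Matrix.updateRow_self, Units.smul_def, Pi.single_apply]
  split_ifs <;> simp

lemma derivation_det (D : Derivation R A M) (g : Matrix n n A) :
    D g.det = ∑ i, ∑ j, g.adjugate j i • D (g i j) := by
  have hrow (i : n) : ∑ j, g.adjugate j i • D (g i j) = ∑ π : Equiv.Perm n,
      ((Equiv.Perm.sign π : ℤ) • ∏ k ∈ Finset.univ.erase i, g k (π k)) • D (g i (π i)) := by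
    simp only [adjugate_apply_eq_sum_perm, Finset.sum_smul]
    rw [Finset.sum_comm]
    exact Finset.sum_congr rfl fun π _ => by simp [ite_smul]
  have hterm (π : Equiv.Perm n) : D (Equiv.Perm.sign π • ∏ i, g i (π i)) = ∑ i,
      ((Equiv.Perm.sign π : ℤ) • ∏ k ∈ Finset.univ.erase i, g k (π k)) • D (g i (π i)) := by
    simp only [Units.smul_def, map_zsmul, derivation_prod, Finset.smul_sum, smul_assoc]
  rw [← Matrix.det_transpose, Matrix.det_apply, map_sum]
  simp only [hrow, hterm, Matrix.transpose_apply]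
  exact Finset.sum_comm

end Jacobi

lemma contractLeft_mul {R M : Type*} [CommRing R] [AddCommGroup M] [Module R M]
    {q : QuadraticForm R M} (d : Module.Dual R M) (x y : CliffordAlgebra q) :
    CliffordAlgebra.contractLeft d (x * y) =
      CliffordAlgebra.contractLeft d x * y +
        CliffordAlgebra.involute x * CliffordAlgebra.contractLeft d y := by
  induction x using CliffordAlgebra.left_induction with
  | algebraMap r =>
    rw [CliffordAlgebra.contractLeft_algebraMap_mul, CliffordAlgebra.contractLeft_algebraMap,
      zero_mul, zero_add, AlgHom.commutes]
  | add x x' hx hx' => simp only [add_mul, map_add, hx, hx']; abel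
  | ι_mul x m hx =>
    rw [mul_assoc, CliffordAlgebra.contractLeft_ι_mul, hx, CliffordAlgebra.contractLeft_ι_mul,
      map_mul, CliffordAlgebra.involute_ι, sub_mul, smul_mul_assoc, mul_add]
    simp only [neg_mul, mul_assoc]
    abel

variable {ι I₀ I₁ : Type*}

section Generators

lemma tmul_eq_ofEven_mul_ofOdd (a : EvenAlg ι I₀) (b : ExteriorAlgebra ℝ (OddJet ι I₁ →₀ ℝ)) :
    (a ⊗ₜ[ℝ] b : EvenAlg ι I₀ ⊗[ℝ] ExteriorAlgebra ℝ (OddJet ι I₁ →₀ ℝ)) =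
      (ofEven a * ofOdd b : LocalAlg ι I₀ I₁) := by
  have h := Algebra.TensorProduct.tmul_mul_tmul (R := ℝ) a 1 1 b
  rw [one_mul, mul_one] at h
  exact h.symm

lemma LocalAlg.induction_mul {p : LocalAlg ι I₀ I₁ → Prop} (mul : ∀ a b, p (ofEven a * ofOdd b))
    (add : ∀ X Y, p X → p Y → p (X + Y)) (X : LocalAlg ι I₀ I₁) : p X := by
  refine TensorProduct.induction_on (motive := p) X ?_ (fun a b => ?_) add
  · have h := mul 0 0
    rwa [map_zero, zero_mul] at h
  · rw [tmul_eq_ofEven_mul_ofOdd]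
    exact mul a b

lemma ofEven_mul_ofOdd_comm (a : EvenAlg ι I₀) (b : ExteriorAlgebra ℝ (OddJet ι I₁ →₀ ℝ)) :
    (ofEven a * ofOdd b : LocalAlg ι I₀ I₁) = ofOdd b * ofEven a := by
  have h := Algebra.TensorProduct.tmul_mul_tmul (R := ℝ) 1 a b 1
  rw [one_mul, mul_one] at h
  rw [← tmul_eq_ofEven_mul_ofOdd]
  exact h.symm

lemma ofEven_mul_ofOdd_mul (a a' : EvenAlg ι I₀)
    (b b' : ExteriorAlgebra ℝ (OddJet ι I₁ →₀ ℝ)) :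
    (ofEven a * ofOdd b * (ofEven a' * ofOdd b') : LocalAlg ι I₀ I₁) =
      ofEven (a * a') * ofOdd (b * b') := by
  rw [map_mul, map_mul, mul_assoc, ← mul_assoc (ofOdd b), ← ofEven_mul_ofOdd_comm, mul_assoc,
    mul_assoc]

/-- The generator `w = 1 / √(-det g)` of the algebra of local functions. -/
noncomputable def invVol : LocalAlg ι I₀ I₁ := ofEven (toEvenAlg ι I₀ (MvPolynomial.X none))

lemma volg_mul_invVol : (volg * invVol : LocalAlg ι I₀ I₁) = 1 := by
  rw [volg, invVol, ← map_mul, ← map_one ofEven, sqrtNegDet]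
  congr 1
  linear_combination -det_metricMatrix ι I₀

lemma mem_of_coordinates_mem (B : Subalgebra ℝ (LocalAlg ι I₀ I₁)) (heven : ∀ z, evenCoord z ∈ B)
    (hvol : invVol ∈ B) (hodd : ∀ z, oddCoord z ∈ B) (X : LocalAlg ι I₀ I₁) : X ∈ B := by
  have hofEven (a : EvenAlg ι I₀) : ofEven a ∈ B := by
    obtain ⟨x, rfl⟩ := toEvenAlg_surjective ι I₀ a
    suffices h : ⊤ ≤ B.comap (ofEven.comp (toEvenAlg ι I₀)) from h trivial
    rw [← MvPolynomial.adjoin_range_X, Algebra.adjoin_le_iff]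
    rintro _ ⟨_ | z, rfl⟩
    exacts [hvol, heven z]
  have hofOdd (b : ExteriorAlgebra ℝ (OddJet ι I₁ →₀ ℝ)) : ofOdd b ∈ B := by
    suffices h : ⊤ ≤ B.comap ofOdd from h trivial
    rw [← CliffordAlgebra.adjoin_range_ι, Algebra.adjoin_le_iff]
    rintro _ ⟨m, rfl⟩
    change ofOdd (ExteriorAlgebra.ι ℝ m) ∈ B
    induction m using Finsupp.induction_linear with
    | zero => simp only [map_zero, B.zero_mem]
    | add m m' hm hm' => rw [map_add, map_add]; exact add_mem hm hm'
    | single z r =>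
      rw [← mul_one r, ← smul_eq_mul, ← Finsupp.smul_single, map_smul, map_smul]
      exact B.smul_mem (hodd z) r
  induction X using LocalAlg.induction_mul with
  | mul a b => exact mul_mem (hofEven a) (hofOdd b)
  | add X Y hX hY => exact add_mem hX hY

end Generators

section GradeInvolution

/-- The grade involution, which changes the sign of the odd coordinates. -/
noncomputable def gradeInv : LocalAlg ι I₀ I₁ →ₐ[ℝ] LocalAlg ι I₀ I₁ :=
  (Algebra.TensorProduct.map (AlgHom.id ℝ (EvenAlg ι I₀)) CliffordAlgebra.involute :
    EvenAlg ι I₀ ⊗[ℝ] ExteriorAlgebra ℝ (OddJet ι I₁ →₀ ℝ) →ₐ[ℝ]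
      EvenAlg ι I₀ ⊗[ℝ] ExteriorAlgebra ℝ (OddJet ι I₁ →₀ ℝ))

@[simp] lemma gradeInv_ofEven (a : EvenAlg ι I₀) :
    gradeInv (ofEven a : LocalAlg ι I₀ I₁) = ofEven a := by
  change Algebra.TensorProduct.map (AlgHom.id ℝ (EvenAlg ι I₀)) CliffordAlgebra.involute
    (a ⊗ₜ[ℝ] (1 : ExteriorAlgebra ℝ (OddJet ι I₁ →₀ ℝ))) = a ⊗ₜ[ℝ] 1
  simp

lemma gradeInv_ofOdd (b : ExteriorAlgebra ℝ (OddJet ι I₁ →₀ ℝ)) :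
    gradeInv (ofOdd b : LocalAlg ι I₀ I₁) = ofOdd (CliffordAlgebra.involute b) := by
  change Algebra.TensorProduct.map (AlgHom.id ℝ (EvenAlg ι I₀)) CliffordAlgebra.involute
    ((1 : EvenAlg ι I₀) ⊗ₜ[ℝ] b) = 1 ⊗ₜ[ℝ] CliffordAlgebra.involute b
  simp

@[simp] lemma gradeInv_evenCoord (z : EvenJet ι I₀) :
    gradeInv (evenCoord z : LocalAlg ι I₀ I₁) = evenCoord z := gradeInv_ofEven _

@[simp] lemma gradeInv_oddCoord (z : OddJet ι I₁) :
    gradeInv (oddCoord z : LocalAlg ι I₀ I₁) = -oddCoord z := by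
  rw [oddCoord, gradeInv_ofOdd, ExteriorAlgebra.ι, CliffordAlgebra.involute_ι, map_neg]

@[simp] lemma gradeInv_gradeInv (X : LocalAlg ι I₀ I₁) : gradeInv (gradeInv X) = X := by
  have h := mem_of_coordinates_mem (AlgHom.equalizer (gradeInv * gradeInv) 1) (fun z => by simp)
    (by simp [invVol]) (fun z => by simp) X
  exact h

lemma gradeInv_mul_gradeInv : (gradeInv * gradeInv : LocalAlg ι I₀ I₁ →ₐ[ℝ] _) = 1 :=
  AlgHom.ext gradeInv_gradeInv

lemma ofEven_mem_twistedCenter (a : EvenAlg ι I₀) :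
    (ofEven a : LocalAlg ι I₀ I₁) ∈ twistedCenter (1 : LocalAlg ι I₀ I₁ →ₐ[ℝ] _) := fun X => by
  induction X using LocalAlg.induction_mul with
  | mul b c =>
    rw [AlgHom.one_apply, mul_assoc, ← ofEven_mul_ofOdd_comm, ← mul_assoc, ← mul_assoc,
      ← map_mul, ← map_mul, mul_comm a b]
  | add X Y hX hY => rw [mul_add, hX, hY, map_add, add_mul]

lemma ofEven_mul_comm (a : EvenAlg ι I₀) (X : LocalAlg ι I₀ I₁) : ofEven a * X = X * ofEven a :=
  ofEven_mem_twistedCenter a X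

lemma oddCoord_mem_twistedCenter (z : OddJet ι I₁) :
    (oddCoord z : LocalAlg ι I₀ I₁) ∈ twistedCenter gradeInv :=
  mem_of_coordinates_mem (twistedCommutant gradeInv (oddCoord z))
    (fun z' => by
      change oddCoord z * evenCoord z' = gradeInv (evenCoord z') * oddCoord z
      rw [gradeInv_evenCoord, evenCoord, ofEven_mul_comm])
    (by
      change oddCoord z * invVol = gradeInv invVol * oddCoord z
      rw [invVol, gradeInv_ofEven, ofEven_mul_comm])
    (fun z' => by
      change oddCoord z * oddCoord z' = gradeInv (oddCoord z') * oddCoord z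
      rw [gradeInv_oddCoord, neg_mul, ← add_eq_zero_iff_eq_neg, oddCoord, oddCoord, ← map_mul ofOdd,
        ← map_mul ofOdd, ← map_add, ExteriorAlgebra.ι_add_mul_swap, map_zero])

end GradeInvolution

section Determinants

variable {σ : LocalAlg ι I₀ I₁ →ₐ[ℝ] LocalAlg ι I₀ I₁} {d : LocalAlg ι I₀ I₁ → LocalAlg ι I₀ I₁}

namespace IsTwistedDer

lemma map_det (h : IsTwistedDer σ d) (hσ : ∀ a, σ (ofEven a) = ofEven a) {n : Type*} [Fintype n]
    [DecidableEq n] (g : Matrix n n (EvenAlg ι I₀)) :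
    d (ofEven g.det) = (g.adjugate.map ofEven * (g.map ofEven).map d).trace := by
  let _ : Module (EvenAlg ι I₀) (LocalAlg ι I₀ I₁) :=
    Module.compHom _ (ofEven : EvenAlg ι I₀ →ₐ[ℝ] LocalAlg ι I₀ I₁).toRingHom
  let D : Derivation ℝ (EvenAlg ι I₀) (LocalAlg ι I₀ I₁) :=
    { toLinearMap := h.toIsLinearMap.mk' d ∘ₗ ofEven.toLinearMap
      map_one_eq_zero' := by
        change d (ofEven 1) = 0
        rw [_root_.map_one, h.map_one]
      leibniz' a b := by
        change d (ofEven (a * b)) = ofEven a * d (ofEven b) + ofEven b * d (ofEven a)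
        rw [map_mul, h.leibniz, hσ, ← ofEven_mul_comm b, add_comm] }
  have hdet : d (ofEven g.det) = ∑ i, ∑ j, ofEven (g.adjugate j i) * d (ofEven (g i j)) :=
    derivation_det D g
  rw [hdet, Finset.sum_comm]
  rfl

lemma map_volg (h : IsTwistedDer σ d) (hσ : ∀ a, σ (ofEven a) = ofEven a) {T : LocalAlg ι I₀ I₁}
    (hdet : d (ofEven (metricMatrix ι I₀).det) = (2 : ℝ) • (T * ofEven (metricMatrix ι I₀).det)) :
    d volg = T * volg := by
  have hsq : (volg * volg : LocalAlg ι I₀ I₁) = -ofEven (metricMatrix ι I₀).det := by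
    rw [volg, ← map_mul, ← pow_two, sqrtNegDet_sq, map_neg]
  have htwice : (2 : ℝ) • (d volg * volg) = (2 : ℝ) • (T * volg * volg) := by
    calc (2 : ℝ) • (d volg * volg) = d (volg * volg) := by
          rw [h.leibniz, volg, hσ, ofEven_mul_comm, two_smul]
      _ = (2 : ℝ) • (T * volg * volg) := by
          rw [mul_assoc, hsq, h.map_neg, hdet, mul_neg, smul_neg]
  have hcancel := smul_right_injective _ (two_ne_zero (α := ℝ)) htwice
  calc d volg = d volg * volg * invVol := by rw [mul_assoc, volg_mul_invVol, mul_one]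
    _ = T * volg := by rw [hcancel, mul_assoc, volg_mul_invVol, mul_one]

lemma map_invVol_eq_zero (h : IsTwistedDer σ d) (hσ : ∀ a, σ (ofEven a) = ofEven a)
    (hmet : ∀ μ ν, d (met μ ν) = 0) : d invVol = 0 := by
  have hdet : d (ofEven (metricMatrix ι I₀).det) = 0 := by
    have hg : ((metricMatrix ι I₀).map ofEven).map d = 0 := Matrix.ext hmet
    rw [h.map_det hσ, hg, mul_zero, Matrix.trace_zero]
  have hvol : d volg = 0 := by
    simpa using h.map_volg hσ (T := 0) (by simpa using hdet)
  have hprod : volg * d invVol = 0 := by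
    have h1 := h.leibniz volg invVol
    rwa [volg_mul_invVol, h.map_one, hvol, zero_mul, zero_add, volg, hσ, eq_comm] at h1
  calc d invVol = invVol * volg * d invVol := by
        rw [invVol, ofEven_mul_comm, ← invVol, volg_mul_invVol, one_mul]
    _ = 0 := by rw [mul_assoc, hprod, mul_zero]

lemma eq_zero_of_coordinates (h : IsTwistedDer σ d) (hσ : ∀ a, σ (ofEven a) = ofEven a)
    (heven : ∀ z, d (evenCoord z) = 0) (hodd : ∀ z, d (oddCoord z) = 0) (X : LocalAlg ι I₀ I₁) :
    d X = 0 :=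
  mem_of_coordinates_mem h.ker heven (h.map_invVol_eq_zero hσ fun _ _ => heven _) hodd X

end IsTwistedDer

end Determinants

section PartialDerivatives

lemma evenPartial_ofEven_mul (z : EvenJet ι I₀) (a : EvenAlg ι I₀)
    (b : ExteriorAlgebra ℝ (OddJet ι I₁ →₀ ℝ)) :
    evenPartial z (ofEven a * ofOdd b : LocalAlg ι I₀ I₁) =
      ofEven (evenAlgPartial z a) * ofOdd b := by
  rw [← tmul_eq_ofEven_mul_ofOdd, ← tmul_eq_ofEven_mul_ofOdd]
  exact TensorProduct.map_tmul _ _ _ _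

lemma oddPartial_ofEven_mul (z : OddJet ι I₁) (a : EvenAlg ι I₀)
    (b : ExteriorAlgebra ℝ (OddJet ι I₁ →₀ ℝ)) :
    oddPartial z (ofEven a * ofOdd b : LocalAlg ι I₀ I₁) =
      ofEven a * ofOdd (CliffordAlgebra.contractLeft (Finsupp.lapply z) b) := by
  rw [← tmul_eq_ofEven_mul_ofOdd, ← tmul_eq_ofEven_mul_ofOdd]
  exact TensorProduct.map_tmul _ _ _ _

lemma isTwistedDer_evenPartial (z : EvenJet ι I₀) :
    IsTwistedDer (1 : LocalAlg ι I₀ I₁ →ₐ[ℝ] _) (evenPartial z) where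
  map_add := map_add _
  map_smul := map_smul _
  leibniz X Y := by
    rw [AlgHom.one_apply]
    induction X using LocalAlg.induction_mul with
    | add X X' hX hX' => simp only [add_mul, map_add, hX, hX']; abel
    | mul a b =>
      induction Y using LocalAlg.induction_mul with
      | add Y Y' hY hY' => simp only [mul_add, map_add, hY, hY']; abel
      | mul a' b' =>
        simp only [ofEven_mul_ofOdd_mul, evenPartial_ofEven_mul, Derivation.leibniz, smul_eq_mul,
          map_add, add_mul]
        rw [add_comm, mul_comm a']

lemma isTwistedDer_oddPartial (z : OddJet ι I₁) :
    IsTwistedDer (gradeInv : LocalAlg ι I₀ I₁ →ₐ[ℝ] _) (oddPartial z) where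
  map_add := map_add _
  map_smul := map_smul _
  leibniz X Y := by
    induction X using LocalAlg.induction_mul with
    | add X X' hX hX' => simp only [add_mul, map_add, hX, hX']; abel
    | mul a b =>
      induction Y using LocalAlg.induction_mul with
      | add Y Y' hY hY' => simp only [mul_add, map_add, hY, hY']; abel
      | mul a' b' =>
        simp only [ofEven_mul_ofOdd_mul, oddPartial_ofEven_mul, map_mul gradeInv, gradeInv_ofEven,
          gradeInv_ofOdd, contractLeft_mul, map_add, mul_add]

lemma evenPartial_evenCoord [DecidableEq (EvenJet ι I₀)] (z z' : EvenJet ι I₀) :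
    evenPartial z (evenCoord z' : LocalAlg ι I₀ I₁) = if z = z' then 1 else 0 := by
  classical
  have h := evenPartial_ofEven_mul (I₁ := I₁) z (toEvenAlg ι I₀ (MvPolynomial.X (some z'))) 1
  have hlift : evenAlgPartial z (toEvenAlg ι I₀ (MvPolynomial.X (some z'))) =
      toEvenAlg ι I₀ (preEvenPartial z (MvPolynomial.X (some z'))) :=
    Derivation.liftOfSurjective_apply _ (preEvenPartial_mem z) _
  rw [map_one, mul_one, mul_one, hlift] at h
  rw [evenCoord, h, preEvenPartial]
  by_cases hz : z = z'
  · subst hz; simp [MvPolynomial.pderiv_X]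
  · simp [MvPolynomial.pderiv_X, hz, eq_comm]

lemma evenPartial_oddCoord (z : EvenJet ι I₀) (z' : OddJet ι I₁) :
    evenPartial z (oddCoord z' : LocalAlg ι I₀ I₁) = 0 := by
  have h := evenPartial_ofEven_mul z (1 : EvenAlg ι I₀)
    (ExteriorAlgebra.ι ℝ (Finsupp.single z' (1 : ℝ)))
  rwa [map_one, one_mul, Derivation.map_one_eq_zero, map_zero, zero_mul] at h

lemma oddPartial_ofEven (z : OddJet ι I₁) (a : EvenAlg ι I₀) :
    oddPartial z (ofEven a : LocalAlg ι I₀ I₁) = 0 := by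
  have h := oddPartial_ofEven_mul z a 1
  rwa [map_one, mul_one, CliffordAlgebra.contractLeft_one, map_zero, mul_zero] at h

lemma oddPartial_oddCoord [DecidableEq (OddJet ι I₁)] (z z' : OddJet ι I₁) :
    oddPartial z (oddCoord z' : LocalAlg ι I₀ I₁) = if z = z' then 1 else 0 := by
  have h := oddPartial_ofEven_mul z (1 : EvenAlg ι I₀)
    (ExteriorAlgebra.ι ℝ (Finsupp.single z' (1 : ℝ)))
  rw [map_one, one_mul, one_mul, ExteriorAlgebra.ι, CliffordAlgebra.contractLeft_ι] at h
  rw [oddCoord, ExteriorAlgebra.ι, h]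
  by_cases hz : z = z' <;> simp [hz]

lemma finite_evenPartial_ne_zero (X : LocalAlg ι I₀ I₁) : {z | evenPartial z X ≠ 0}.Finite := by
  classical
  have hcoord (z' : EvenJet ι I₀) (z) (hz : evenPartial z (evenCoord z' : LocalAlg ι I₀ I₁) ≠ 0) :
      z = z' := by
    by_contra hne
    exact hz (by rw [evenPartial_evenCoord, if_neg hne])
  refine mem_of_coordinates_mem (IsTwistedDer.finiteSupport isTwistedDer_evenPartial)
    (fun z' => (Set.finite_singleton z').subset (hcoord z')) ?_
    (fun z' => by simp [IsTwistedDer.finiteSupport, evenPartial_oddCoord]) X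
  refine (Set.finite_range fun p : Sym2 (Fin 4) => ((.metric p, 0) : EvenJet ι I₀)).subset
    fun z hz => by_contra fun hz' => hz ?_
  exact (isTwistedDer_evenPartial z).map_invVol_eq_zero (fun _ => rfl) fun μ ν =>
    by_contra fun hmet => hz' ⟨_, (hcoord _ z hmet).symm⟩

lemma finite_oddPartial_ne_zero (X : LocalAlg ι I₀ I₁) : {z | oddPartial z X ≠ 0}.Finite := by
  classical
  refine mem_of_coordinates_mem (IsTwistedDer.finiteSupport isTwistedDer_oddPartial)
    (fun z' => by simp [IsTwistedDer.finiteSupport, evenCoord, oddPartial_ofEven])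
    (by simp [IsTwistedDer.finiteSupport, invVol, oddPartial_ofEven])
    (fun z' => (Set.finite_singleton z').subset fun z hz => ?_) X
  by_contra hne
  exact hz ((oddPartial_oddCoord z z').trans (if_neg hne))

end PartialDerivatives

section VectorFields

variable {σ : LocalAlg ι I₀ I₁ →ₐ[ℝ] LocalAlg ι I₀ I₁} {V : EvenJet ι I₀ → LocalAlg ι I₀ I₁}
  {W : OddJet ι I₁ → LocalAlg ι I₀ I₁}

lemma isTwistedDer_vectorField (hV : ∀ z, V z ∈ twistedCenter σ)
    (hW : ∀ z, W z ∈ twistedCenter (σ * gradeInv)) : IsTwistedDer σ (vectorField V W) := by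
  have heven : IsTwistedDer σ fun X => ∑ᶠ z, V z * evenPartial z X :=
    .finsum (fun z => mul_one σ ▸ (isTwistedDer_evenPartial z).mul_left (hV z)) fun X =>
      (finite_evenPartial_ne_zero X).subset fun z hz h => hz (by rw [h, mul_zero])
  have hodd : IsTwistedDer σ fun X => ∑ᶠ z, W z * oddPartial z X := by
    refine .finsum (fun z => ?_) fun X =>
      (finite_oddPartial_ne_zero X).subset fun z hz h => hz (by rw [h, mul_zero])
    have h := (isTwistedDer_oddPartial z).mul_left (hW z)
    rwa [mul_assoc, gradeInv_mul_gradeInv, mul_one] at h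
  exact heven.add hodd

@[simp] lemma vectorField_evenCoord (z : EvenJet ι I₀) : vectorField V W (evenCoord z) = V z := by
  classical
  have hodd (z' : OddJet ι I₁) : oddPartial z' (evenCoord z : LocalAlg ι I₀ I₁) = 0 :=
    oddPartial_ofEven z' _
  simp only [vectorField, evenPartial_evenCoord, hodd, mul_zero, finsum_zero, add_zero]
  rw [finsum_eq_single _ z fun z' h => by rw [if_neg h, mul_zero], if_pos rfl, mul_one]

@[simp] lemma vectorField_oddCoord (z : OddJet ι I₁) : vectorField V W (oddCoord z) = W z := by
  classical
  simp only [vectorField, oddPartial_oddCoord, evenPartial_oddCoord, mul_zero, finsum_zero,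
    zero_add]
  rw [finsum_eq_single _ z fun z' h => by rw [if_neg h, mul_zero], if_pos rfl, mul_one]

end VectorFields

section TotalDerivatives

lemma isTwistedDer_totalD (μ : Fin 4) :
    IsTwistedDer (1 : LocalAlg ι I₀ I₁ →ₐ[ℝ] _) (totalD μ) :=
  isTwistedDer_vectorField (fun _ => ofEven_mem_twistedCenter _) fun _ =>
    (one_mul (gradeInv (ι := ι) (I₀ := I₀) (I₁ := I₁))).symm ▸ oddCoord_mem_twistedCenter _

lemma totalD_mul (μ : Fin 4) (X Y : LocalAlg ι I₀ I₁) :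
    totalD μ (X * Y) = totalD μ X * Y + X * totalD μ Y := (isTwistedDer_totalD μ).leibniz X Y

@[simp] lemma totalD_evenCoord (μ : Fin 4) (z : EvenJet ι I₀) :
    totalD μ (evenCoord z : LocalAlg ι I₀ I₁) = evenCoord (z.1, z.2 + Pi.single μ 1) :=
  vectorField_evenCoord z

@[simp] lemma totalD_oddCoord (μ : Fin 4) (z : OddJet ι I₁) :
    totalD μ (oddCoord z : LocalAlg ι I₀ I₁) = oddCoord (z.1, z.2 + Pi.single μ 1) :=
  vectorField_oddCoord z

lemma totalD_comm (μ ν : Fin 4) (X : LocalAlg ι I₀ I₁) :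
    totalD μ (totalD ν X) = totalD ν (totalD μ X) :=
  sub_eq_zero.1 (((isTwistedDer_totalD μ).commutator (isTwistedDer_totalD ν)
    fun _ => rfl).eq_zero_of_coordinates (fun _ => rfl) (fun z => by simp [add_right_comm])
    (fun z => by simp [add_right_comm]) X)

lemma gradeInv_totalD (μ : Fin 4) (X : LocalAlg ι I₀ I₁) :
    gradeInv (totalD μ X) = totalD μ (gradeInv X) := by
  have hμ := isTwistedDer_totalD (ι := ι) (I₀ := I₀) (I₁ := I₁) μ
  have h := ((hμ.conj gradeInv_gradeInv gradeInv_gradeInv).sub hμ).eq_zero_of_coordinates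
    (fun _ => rfl) (fun z => by simp) (fun z => by simp [hμ.map_neg]) (gradeInv X)
  rwa [gradeInv_gradeInv, sub_eq_zero] at h

lemma iterD_add_single (J : MultiIndex) (μ : Fin 4) (X : LocalAlg ι I₀ I₁) :
    iterD (J + Pi.single μ 1) X = totalD μ (iterD J X) := by
  have hcomm (ν ρ : Fin 4) (n : ℕ) (Y : LocalAlg ι I₀ I₁) :
      (totalD ν)^[n] (totalD ρ Y) = totalD ρ ((totalD ν)^[n] Y) :=
    Function.Commute.iterate_left (totalD_comm ν ρ) n Y
  fin_cases μ <;> simp [iterD, Function.iterate_succ_apply, hcomm]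

lemma iterD_mem (S : Set (LocalAlg ι I₀ I₁)) (hS : ∀ μ, ∀ X ∈ S, totalD μ X ∈ S)
    (J : MultiIndex) {X : LocalAlg ι I₀ I₁} (hX : X ∈ S) : iterD J X ∈ S := by
  have hiter (μ : Fin 4) (n : ℕ) : Set.MapsTo (totalD μ)^[n] S S :=
    Set.MapsTo.iterate (hS μ) n
  exact hiter _ _ (hiter _ _ (hiter _ _ (hiter _ _ hX)))

/-- The total derivatives `∂_μ J^μ`; equality of densities modulo total derivatives is congruence
modulo this subspace. -/
def totalDerivatives (ι I₀ I₁ : Type*) : Submodule ℝ (LocalAlg ι I₀ I₁) where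
  carrier := {X | ∃ J : Fin 4 → LocalAlg ι I₀ I₁, X = ∑ μ, totalD μ (J μ)}
  add_mem' := by
    rintro _ _ ⟨J, rfl⟩ ⟨J', rfl⟩
    exact ⟨J + J', by simp only [Pi.add_apply, (isTwistedDer_totalD _).map_add,
      Finset.sum_add_distrib]⟩
  zero_mem' := ⟨0, by simp only [Pi.zero_apply, (isTwistedDer_totalD _).map_zero,
    Finset.sum_const_zero]⟩
  smul_mem' := by
    rintro r _ ⟨J, rfl⟩
    exact ⟨r • J, by simp only [Pi.smul_apply, (isTwistedDer_totalD _).map_smul,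
      Finset.smul_sum]⟩

end TotalDerivatives

section Parity

/-- The elements with central even part and odd part in the twisted center, which turn out to be all
elements.  Encoded without the factor `1/2` in the projections to the two parts. -/
noncomputable def supercenter (ι I₀ I₁ : Type*) : Subalgebra ℝ (LocalAlg ι I₀ I₁) where
  carrier := {X | X + gradeInv X ∈ twistedCenter (1 : LocalAlg ι I₀ I₁ →ₐ[ℝ] _) ∧
    X - gradeInv X ∈ twistedCenter (gradeInv : LocalAlg ι I₀ I₁ →ₐ[ℝ] _)}
  add_mem' {X Y} hX hY := by
    have hadd := add_mem hX.1 hY.1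
    have hsub := add_mem hX.2 hY.2
    rw [add_add_add_comm, ← map_add gradeInv] at hadd
    rw [← add_sub_add_comm, ← map_add gradeInv] at hsub
    exact ⟨hadd, hsub⟩
  mul_mem' {X Y} hX hY := by
    have hee := mul_mem_twistedCenter hX.1 hY.1
    have hoo := mul_mem_twistedCenter hX.2 hY.2
    have heo := mul_mem_twistedCenter hX.1 hY.2
    have hoe := mul_mem_twistedCenter hX.2 hY.1
    rw [mul_one] at hee hoe
    rw [one_mul] at heo
    rw [gradeInv_mul_gradeInv] at hoo
    have hadd := Submodule.smul_mem _ (1 / 2 : ℝ) (add_mem hee hoo)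
    have hsub := Submodule.smul_mem _ (1 / 2 : ℝ) (add_mem heo hoe)
    have heven : (1 / 2 : ℝ) • ((X + gradeInv X) * (Y + gradeInv Y) +
        (X - gradeInv X) * (Y - gradeInv Y)) = X * Y + gradeInv (X * Y) := by
      rw [map_mul gradeInv, one_div, inv_smul_eq_iff₀ two_ne_zero, two_smul]
      noncomm_ring
    have hodd : (1 / 2 : ℝ) • ((X + gradeInv X) * (Y - gradeInv Y) +
        (X - gradeInv X) * (Y + gradeInv Y)) = X * Y - gradeInv (X * Y) := by
      rw [map_mul gradeInv, one_div, inv_smul_eq_iff₀ two_ne_zero, two_smul]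
      noncomm_ring
    exact ⟨heven ▸ hadd, hodd ▸ hsub⟩
  algebraMap_mem' r := by
    have hr : algebraMap ℝ (LocalAlg ι I₀ I₁) r ∈ twistedCenter (1 : LocalAlg ι I₀ I₁ →ₐ[ℝ] _) :=
      fun X => Algebra.commutes r X
    refine ⟨?_, ?_⟩
    · rw [AlgHom.commutes]
      exact add_mem hr hr
    · rw [AlgHom.commutes, sub_self]
      exact zero_mem _

lemma mem_supercenter (X : LocalAlg ι I₀ I₁) : X ∈ supercenter ι I₀ I₁ := by
  have hofEven (a : EvenAlg ι I₀) : ofEven a ∈ supercenter ι I₀ I₁ := by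
    refine ⟨?_, ?_⟩
    · rw [gradeInv_ofEven]
      exact add_mem (ofEven_mem_twistedCenter a) (ofEven_mem_twistedCenter a)
    · rw [gradeInv_ofEven, sub_self]
      exact zero_mem _
  refine mem_of_coordinates_mem _ (fun _ => hofEven _) (hofEven _) (fun z => ⟨?_, ?_⟩) X
  · rw [gradeInv_oddCoord, add_neg_cancel]
    exact zero_mem _
  · rw [gradeInv_oddCoord, sub_neg_eq_add]
    exact add_mem (oddCoord_mem_twistedCenter z) (oddCoord_mem_twistedCenter z)

/-- The local functions of degree `n`; only the parity of `n` matters. -/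
noncomputable def homogeneous (ι I₀ I₁ : Type*) (n : ℕ) : Submodule ℝ (LocalAlg ι I₀ I₁) :=
  Module.End.eigenspace (gradeInv : LocalAlg ι I₀ I₁ →ₐ[ℝ] _).toLinearMap ((-1) ^ n)

variable {m n : ℕ} {X Y : LocalAlg ι I₀ I₁}

lemma mem_homogeneous_iff : X ∈ homogeneous ι I₀ I₁ n ↔ gradeInv X = (-1 : ℝ) ^ n • X :=
  Module.End.mem_eigenspace_iff

lemma homogeneous_add_two : homogeneous ι I₀ I₁ (n + 2) = homogeneous ι I₀ I₁ n := by
  rw [homogeneous, homogeneous, pow_add, neg_one_sq, mul_one]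

lemma mul_mem_homogeneous (hX : X ∈ homogeneous ι I₀ I₁ m) (hY : Y ∈ homogeneous ι I₀ I₁ n) :
    X * Y ∈ homogeneous ι I₀ I₁ (m + n) := by
  rw [mem_homogeneous_iff] at *
  rw [map_mul gradeInv, hX, hY, smul_mul_smul_comm, pow_add]

lemma ofEven_mem_homogeneous (a : EvenAlg ι I₀) : ofEven a ∈ homogeneous ι I₀ I₁ 0 := by
  rw [mem_homogeneous_iff, gradeInv_ofEven, pow_zero, one_smul]

lemma oddCoord_mem_homogeneous (z : OddJet ι I₁) : oddCoord z ∈ homogeneous ι I₀ I₁ 1 := by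
  rw [mem_homogeneous_iff, gradeInv_oddCoord, pow_one, neg_one_smul]

lemma totalD_mem_homogeneous (μ : Fin 4) (hX : X ∈ homogeneous ι I₀ I₁ n) :
    totalD μ X ∈ homogeneous ι I₀ I₁ n := by
  rw [mem_homogeneous_iff] at *
  rw [gradeInv_totalD, hX, (isTwistedDer_totalD μ).map_smul]

lemma mem_twistedCenter_of_even (hX : X ∈ homogeneous ι I₀ I₁ 0) :
    X ∈ twistedCenter (1 : LocalAlg ι I₀ I₁ →ₐ[ℝ] _) := by
  rw [mem_homogeneous_iff, pow_zero, one_smul] at hX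
  have h := (mem_supercenter X).1
  rwa [hX, ← two_smul ℝ, Submodule.smul_mem_iff _ two_ne_zero] at h

lemma mem_twistedCenter_of_odd (hX : X ∈ homogeneous ι I₀ I₁ 1) :
    X ∈ twistedCenter (gradeInv : LocalAlg ι I₀ I₁ →ₐ[ℝ] _) := by
  rw [mem_homogeneous_iff, pow_one, neg_one_smul] at hX
  have h := (mem_supercenter X).2
  rwa [hX, sub_neg_eq_add, ← two_smul ℝ, Submodule.smul_mem_iff _ two_ne_zero] at h

end Parity

section Degrees

variable {𝔤 : Type*} [LieRing 𝔤] [LieAlgebra ℝ 𝔤]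
  {K : Fin 4 → LocalAlg ι I₀ I₁} {m n : ℕ}

lemma lieScalar_mem_homogeneous (hK : ∀ ρ, K ρ ∈ homogeneous ι I₀ I₁ m) {φ : LocalAlg ι I₀ I₁}
    (hφ : φ ∈ homogeneous ι I₀ I₁ n) : lieScalar K φ ∈ homogeneous ι I₀ I₁ (m + n) :=
  sum_mem fun ρ _ => mul_mem_homogeneous (hK ρ) (totalD_mem_homogeneous ρ hφ)

lemma lieCovector_mem_homogeneous (hK : ∀ ρ, K ρ ∈ homogeneous ι I₀ I₁ m)
    {X : Fin 4 → LocalAlg ι I₀ I₁} (hX : ∀ μ, X μ ∈ homogeneous ι I₀ I₁ n) (μ : Fin 4) :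
    lieCovector K X μ ∈ homogeneous ι I₀ I₁ (m + n) :=
  sum_mem fun ρ _ => add_mem (mul_mem_homogeneous (hK ρ) (totalD_mem_homogeneous ρ (hX μ)))
    (mul_mem_homogeneous (totalD_mem_homogeneous μ (hK ρ)) (hX ρ))

lemma lieMetricSym_mem_homogeneous (hK : ∀ ρ, K ρ ∈ homogeneous ι I₀ I₁ m) (p : Sym2 (Fin 4)) :
    lieMetricSym K p ∈ homogeneous ι I₀ I₁ m := by
  have hmet (μ ν : Fin 4) : met μ ν ∈ homogeneous ι I₀ I₁ 0 := ofEven_mem_homogeneous _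
  induction p using Sym2.ind with
  | _ μ ν =>
    change lieMetric K μ ν ∈ homogeneous ι I₀ I₁ (m + 0)
    exact sum_mem fun ρ _ => add_mem (add_mem
      (mul_mem_homogeneous (hK ρ) (totalD_mem_homogeneous ρ (hmet μ ν)))
      (mul_mem_homogeneous (totalD_mem_homogeneous μ (hK ρ)) (hmet ρ ν)))
      (mul_mem_homogeneous (totalD_mem_homogeneous ν (hK ρ)) (hmet μ ρ))

lemma lieMatter_mem_homogeneous {I : Type*} [Fintype I] (M : Multiplet 𝔤 I)
    (hK : ∀ ρ, K ρ ∈ homogeneous ι I₀ I₁ m) {φ : I → LocalAlg ι I₀ I₁}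
    (hφ : ∀ i, φ i ∈ homogeneous ι I₀ I₁ n) (i : I) :
    lieMatter M K φ i ∈ homogeneous ι I₀ I₁ (m + n) :=
  sub_mem (lieScalar_mem_homogeneous hK (hφ i)) (sum_mem fun μ _ => sum_mem fun ν _ =>
    sum_mem fun j _ => Submodule.smul_mem _ _
      (mul_mem_homogeneous (totalD_mem_homogeneous ν (hK μ)) (hφ j)))

variable [Fintype ι]

lemma gaugeMatter_mem_homogeneous {I : Type*} [Fintype I] (M : Multiplet 𝔤 I)
    (e : Module.Basis ι ℝ 𝔤) {k : ι → LocalAlg ι I₀ I₁}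
    (hk : ∀ a, k a ∈ homogeneous ι I₀ I₁ m) {φ : I → LocalAlg ι I₀ I₁}
    (hφ : ∀ i, φ i ∈ homogeneous ι I₀ I₁ n) (i : I) :
    gaugeMatter M e k φ i ∈ homogeneous ι I₀ I₁ (m + n) :=
  sum_mem fun a _ => sum_mem fun j _ => Submodule.smul_mem _ _ (mul_mem_homogeneous (hk a) (hφ j))

lemma colorBracket_mem_homogeneous (e : Module.Basis ι ℝ 𝔤) {x y : ι → LocalAlg ι I₀ I₁}
    (hx : ∀ a, x a ∈ homogeneous ι I₀ I₁ m) (hy : ∀ a, y a ∈ homogeneous ι I₀ I₁ n) (a : ι) :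
    colorBracket e x y a ∈ homogeneous ι I₀ I₁ (m + n) :=
  sum_mem fun b _ => sum_mem fun c _ => Submodule.smul_mem _ _ (mul_mem_homogeneous (hx b) (hy c))

end Degrees

section Evolutionary

/-- An odd derivation that commutes with the total derivatives, that is, an odd evolutionary vector
field on the jets of the fields. -/
structure IsEvolutionary (R : LocalAlg ι I₀ I₁ → LocalAlg ι I₀ I₁) : Prop
    extends IsTwistedDer gradeInv R where
  map_totalD : ∀ μ X, R (totalD μ X) = totalD μ (R X)
  map_gradeInv : ∀ X, R (gradeInv X) = -gradeInv (R X)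

section Prolong

variable {p : EvenField ι I₀ → LocalAlg ι I₀ I₁} {q : OddField ι I₁ → LocalAlg ι I₀ I₁}

@[simp] lemma prolong_evenCoord (z : EvenJet ι I₀) :
    prolong p q (evenCoord z) = iterD z.2 (p z.1) := vectorField_evenCoord z

@[simp] lemma prolong_oddCoord (z : OddJet ι I₁) :
    prolong p q (oddCoord z) = iterD z.2 (q z.1) := vectorField_oddCoord z

lemma iterD_mem_homogeneous (J : MultiIndex) {n : ℕ} {X : LocalAlg ι I₀ I₁}
    (hX : X ∈ homogeneous ι I₀ I₁ n) : iterD J X ∈ homogeneous ι I₀ I₁ n :=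
  iterD_mem (homogeneous ι I₀ I₁ n : Set (LocalAlg ι I₀ I₁))
    (fun μ _ => totalD_mem_homogeneous μ) J hX

lemma isTwistedDer_prolong (hp : ∀ u, p u ∈ homogeneous ι I₀ I₁ 1)
    (hq : ∀ θ, q θ ∈ homogeneous ι I₀ I₁ 0) : IsTwistedDer gradeInv (prolong p q) := by
  refine isTwistedDer_vectorField
    (fun z => mem_twistedCenter_of_odd (iterD_mem_homogeneous _ (hp _))) fun z => ?_
  rw [gradeInv_mul_gradeInv]
  exact mem_twistedCenter_of_even (iterD_mem_homogeneous _ (hq _))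

lemma isEvolutionary_prolong (hp : ∀ u, p u ∈ homogeneous ι I₀ I₁ 1)
    (hq : ∀ θ, q θ ∈ homogeneous ι I₀ I₁ 0) : IsEvolutionary (prolong p q) where
  __ := isTwistedDer_prolong hp hq
  map_totalD μ X := by
    have h := (isTwistedDer_prolong hp hq).commutator (isTwistedDer_totalD μ) (gradeInv_totalD μ)
    refine sub_eq_zero.1 (h.eq_zero_of_coordinates gradeInv_ofEven (fun z => ?_) (fun z => ?_) X)
      <;> simp [iterD_add_single]
  map_gradeInv X := by
    have hR := isTwistedDer_prolong hp hq
    have h := (hR.conj gradeInv_gradeInv fun X => by simp only [gradeInv_gradeInv]).add hR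
    have hX := h.eq_zero_of_coordinates gradeInv_ofEven (fun z => ?_) (fun z => ?_) X
    · rw [← gradeInv_gradeInv (prolong p q _), eq_neg_of_add_eq_zero_left hX, map_neg gradeInv]
    · have hz := mem_homogeneous_iff.1 (iterD_mem_homogeneous z.2 (hp z.1))
      rw [gradeInv_evenCoord, prolong_evenCoord, hz, pow_one, neg_one_smul, neg_add_cancel]
    · have hz := mem_homogeneous_iff.1 (iterD_mem_homogeneous z.2 (hq z.1))
      rw [gradeInv_oddCoord, hR.map_neg, prolong_oddCoord, map_neg gradeInv, hz, pow_zero,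
        one_smul, neg_add_cancel]

end Prolong

end Evolutionary

section Metric

open scoped Matrix

/-- The metric as a matrix of local functions. -/
noncomputable def localMetric (ι I₀ I₁ : Type*) : Matrix (Fin 4) (Fin 4) (LocalAlg ι I₀ I₁) :=
  .of met

/-- The inverse metric as a matrix of local functions. -/
noncomputable def localMetricInv (ι I₀ I₁ : Type*) : Matrix (Fin 4) (Fin 4) (LocalAlg ι I₀ I₁) :=
  .of metInv

lemma localMetric_mul_localMetricInv : localMetric ι I₀ I₁ * localMetricInv ι I₀ I₁ = 1 := by
  change (metricMatrix ι I₀).map ofEven * (metricMatrix ι I₀)⁻¹.map ofEven = 1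
  rw [← Matrix.map_mul, Matrix.mul_nonsing_inv _ (isUnit_det_metricMatrix ι I₀),
    Matrix.map_one _ (map_zero _) (map_one _)]

lemma localMetricInv_mul_localMetric : localMetricInv ι I₀ I₁ * localMetric ι I₀ I₁ = 1 := by
  change (metricMatrix ι I₀)⁻¹.map ofEven * (metricMatrix ι I₀).map ofEven = 1
  rw [← Matrix.map_mul, Matrix.nonsing_inv_mul _ (isUnit_det_metricMatrix ι I₀),
    Matrix.map_one _ (map_zero _) (map_one _)]

lemma metInv_comm (μ ν : Fin 4) : (metInv μ ν : LocalAlg ι I₀ I₁) = metInv ν μ := by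
  have hsymm : (metricMatrix ι I₀)ᵀ = metricMatrix ι I₀ := by
    ext i j
    simp only [metricMatrix, Matrix.transpose_apply, Matrix.of_apply, Sym2.eq_swap]
  rw [metInv, metInv, ← Matrix.transpose_apply (metricMatrix ι I₀)⁻¹, Matrix.transpose_nonsing_inv,
    hsymm]

namespace IsTwistedDer

variable {σ : LocalAlg ι I₀ I₁ →ₐ[ℝ] LocalAlg ι I₀ I₁} {d : LocalAlg ι I₀ I₁ → LocalAlg ι I₀ I₁}
  {Λ : Matrix (Fin 4) (Fin 4) (LocalAlg ι I₀ I₁)}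

lemma map_volg_eq_trace_mul (h : IsTwistedDer σ d) (hσ : ∀ a, σ (ofEven a) = ofEven a)
    (hmet : (localMetric ι I₀ I₁).map d = Λ * localMetric ι I₀ I₁ + localMetric ι I₀ I₁ * Λᵀ) :
    d volg = Λ.trace * volg := by
  set g := metricMatrix ι I₀
  set detOne : Matrix (Fin 4) (Fin 4) (EvenAlg ι I₀) := g.det • 1 with hdetOne
  have hcyc (N : Matrix (Fin 4) (Fin 4) (LocalAlg ι I₀ I₁)) (M : Matrix _ _ (EvenAlg ι I₀)) :
      (M.map ofEven * N).trace = (N * M.map ofEven).trace :=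
    trace_mul_comm_of_commute fun _ _ _ _ => ofEven_mul_comm _ _
  have hdet (N : Matrix (Fin 4) (Fin 4) (LocalAlg ι I₀ I₁)) :
      (N * detOne.map ofEven).trace = N.trace * ofEven g.det := by
    simp [hdetOne, Matrix.trace, Matrix.mul_apply, Matrix.one_apply, Finset.sum_mul, apply_ite]
  have hleft : g.adjugate.map ofEven * localMetric ι I₀ I₁ = detOne.map ofEven := by
    rw [hdetOne, ← Matrix.adjugate_mul, Matrix.map_mul]
    rfl
  have hright : localMetric ι I₀ I₁ * g.adjugate.map ofEven = detOne.map ofEven := by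
    rw [hdetOne, ← Matrix.mul_adjugate, Matrix.map_mul]
    rfl
  refine h.map_volg hσ ?_
  calc d (ofEven g.det)
      = (g.adjugate.map ofEven * (localMetric ι I₀ I₁).map d).trace := h.map_det hσ g
    _ = (g.adjugate.map ofEven * (Λ * localMetric ι I₀ I₁)).trace +
          (g.adjugate.map ofEven * localMetric ι I₀ I₁ * Λᵀ).trace := by
        rw [hmet, mul_add, Matrix.trace_add, mul_assoc]
    _ = (Λ * detOne.map ofEven).trace + (Λᵀ * detOne.map ofEven).trace := by
        rw [hcyc, mul_assoc, hright, hleft, hcyc]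
    _ = (2 : ℝ) • (Λ.trace * ofEven g.det) := by
        rw [hdet, hdet, Matrix.trace_transpose, two_smul]

lemma contraction_mem_ker (h : IsTwistedDer σ d) (hσ : ∀ a, σ (ofEven a) = ofEven a)
    (hmet : (localMetric ι I₀ I₁).map d = Λ * localMetric ι I₀ I₁ + localMetric ι I₀ I₁ * Λᵀ)
    (hΛ : ∀ μ ν, Λ μ ν ∈ twistedCenter σ) {X Y : Fin 4 → LocalAlg ι I₀ I₁}
    (hX : X ∈ h.covectors Λ) (hY : Y ∈ h.covectors Λ) :
    ∑ μ, ∑ ν, metInv μ ν * X μ * Y ν ∈ h.ker := by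
  have hinv : (localMetricInv ι I₀ I₁).map σ = localMetricInv ι I₀ I₁ :=
    Matrix.ext fun _ _ => hσ _
  have hXup := h.mulVec_mem_covectors (h.map_inverse_matrix hmet localMetric_mul_localMetricInv
    localMetricInv_mul_localMetric hinv) hinv hX
  convert h.dotProduct_mem_ker hΛ hXup hY using 1
  rw [Finset.sum_comm]
  simp only [dotProduct, Matrix.mulVec, Finset.sum_mul, localMetricInv, Matrix.of_apply,
    metInv_comm]

end IsTwistedDer

end Metric

section DiffeoOperators

open scoped Matrix

variable {K : Fin 4 → LocalAlg ι I₀ I₁} {R : LocalAlg ι I₀ I₁ → LocalAlg ι I₀ I₁}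

lemma lieScalar_smul (r : ℝ) (φ : LocalAlg ι I₀ I₁) :
    lieScalar (r • K) φ = r • lieScalar K φ := by
  simp only [lieScalar, Pi.smul_apply, smul_mul_assoc, Finset.smul_sum]

lemma lieCovector_smul (r : ℝ) (X : Fin 4 → LocalAlg ι I₀ I₁) (μ : Fin 4) :
    lieCovector (r • K) X μ = r • lieCovector K X μ := by
  simp only [lieCovector, Pi.smul_apply, (isTwistedDer_totalD _).map_smul, smul_mul_assoc,
    ← smul_add, Finset.smul_sum]

lemma lieMetric_smul (r : ℝ) (μ ν : Fin 4) :
    lieMetric (r • K) μ ν = r • lieMetric K μ ν := by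
  simp only [lieMetric, Pi.smul_apply, (isTwistedDer_totalD _).map_smul, smul_mul_assoc,
    ← smul_add, Finset.smul_sum]

lemma isTwistedDer_lieScalar (hK : ∀ ρ, K ρ ∈ homogeneous ι I₀ I₁ 1) :
    IsTwistedDer gradeInv (lieScalar K) := by
  have h := IsTwistedDer.finsum
    (fun ρ => (isTwistedDer_totalD ρ).mul_left (mem_twistedCenter_of_odd (hK ρ)))
    fun X => Set.toFinite _
  simp only [finsum_eq_sum_of_fintype, mul_one] at h
  exact h

lemma lieScalar_gradeInv (hK : ∀ ρ, K ρ ∈ homogeneous ι I₀ I₁ 1) (X : LocalAlg ι I₀ I₁) :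
    lieScalar K (gradeInv X) = -gradeInv (lieScalar K X) := by
  have hK' (ρ : Fin 4) : gradeInv (K ρ) = -K ρ := by
    rw [mem_homogeneous_iff.1 (hK ρ), pow_one, neg_one_smul]
  simp only [lieScalar, _root_.map_sum, map_mul, hK', gradeInv_totalD, neg_mul,
    Finset.sum_neg_distrib, neg_neg]

/-- An odd evolutionary vector field which acts on the metric as the Lie derivative along the odd
vector field `K`. -/
structure IsDiffeoOp (K : Fin 4 → LocalAlg ι I₀ I₁) (R : LocalAlg ι I₀ I₁ → LocalAlg ι I₀ I₁) :
    Prop extends IsEvolutionary R where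
  odd : ∀ ρ, K ρ ∈ homogeneous ι I₀ I₁ 1
  map_met : ∀ μ ν, R (met μ ν) = lieMetric K μ ν

/-- The action of `R` without the transport term of the Lie derivative along `K`.  On tensors it is
linear over the local functions which are scalars. -/
noncomputable def frameVariation (K : Fin 4 → LocalAlg ι I₀ I₁)
    (R : LocalAlg ι I₀ I₁ → LocalAlg ι I₀ I₁) (X : LocalAlg ι I₀ I₁) : LocalAlg ι I₀ I₁ :=
  R X - lieScalar K X

/-- The matrix `∂_μ K^ρ` by which the frame variation acts on covectors. -/
noncomputable def jacobian (K : Fin 4 → LocalAlg ι I₀ I₁) :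
    Matrix (Fin 4) (Fin 4) (LocalAlg ι I₀ I₁) :=
  .of fun μ ρ => totalD μ (K ρ)

namespace IsDiffeoOp

lemma isTwistedDer_frameVariation (h : IsDiffeoOp K R) :
    IsTwistedDer gradeInv (frameVariation K R) :=
  h.toIsTwistedDer.sub (isTwistedDer_lieScalar h.odd)

lemma jacobian_mem_twistedCenter (h : IsDiffeoOp K R) (μ ν : Fin 4) :
    jacobian K μ ν ∈ twistedCenter gradeInv :=
  mem_twistedCenter_of_odd (totalD_mem_homogeneous μ (h.odd ν))

lemma localMetric_map_frameVariation (h : IsDiffeoOp K R) :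
    (localMetric ι I₀ I₁).map (frameVariation K R) =
      jacobian K * localMetric ι I₀ I₁ + localMetric ι I₀ I₁ * (jacobian K)ᵀ := by
  ext μ ν
  have hmet (μ ρ : Fin 4) (X : LocalAlg ι I₀ I₁) : met μ ρ * X = X * met μ ρ := ofEven_mul_comm _ X
  change R (met μ ν) - lieScalar K (met μ ν) =
    ∑ ρ, totalD μ (K ρ) * met ρ ν + ∑ ρ, met μ ρ * totalD ν (K ρ)
  simp only [h.map_met, lieMetric, lieScalar, Finset.sum_add_distrib, hmet μ]
  abel

/-- The local functions on which `R` acts as the Lie derivative of a scalar along `K`. -/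
noncomputable def scalars (h : IsDiffeoOp K R) : Subalgebra ℝ (LocalAlg ι I₀ I₁) :=
  h.isTwistedDer_frameVariation.ker

/-- The quadruples of local functions on which `R` acts as the Lie derivative of a covector
along `K`. -/
noncomputable def covectors (h : IsDiffeoOp K R) : Submodule ℝ (Fin 4 → LocalAlg ι I₀ I₁) :=
  h.isTwistedDer_frameVariation.covectors (jacobian K)

lemma mem_scalars (h : IsDiffeoOp K R) {S : LocalAlg ι I₀ I₁} :
    S ∈ h.scalars ↔ R S = lieScalar K S :=
  sub_eq_zero

lemma mem_covectors (h : IsDiffeoOp K R) {X : Fin 4 → LocalAlg ι I₀ I₁} :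
    X ∈ h.covectors ↔ ∀ μ, R (X μ) = lieCovector K X μ := by
  refine forall_congr' fun μ => ?_
  rw [lieCovector, Finset.sum_add_distrib, add_comm]
  exact sub_eq_iff_eq_add

lemma gradeInv_mem_scalars (h : IsDiffeoOp K R) (S : LocalAlg ι I₀ I₁) (hS : S ∈ h.scalars) :
    gradeInv S ∈ h.scalars := by
  rw [mem_scalars, h.map_gradeInv, h.mem_scalars.1 hS, lieScalar_gradeInv h.odd]

lemma mul_mem_covectors (h : IsDiffeoOp K R) {S : LocalAlg ι I₀ I₁} (hS : S ∈ h.scalars)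
    {X : Fin 4 → LocalAlg ι I₀ I₁} (hX : X ∈ h.covectors) :
    (fun μ => S * X μ) ∈ h.covectors :=
  h.isTwistedDer_frameVariation.scalar_mul_mem_covectors h.jacobian_mem_twistedCenter hS hX

lemma totalD_mem_covectors (h : IsDiffeoOp K R) {S : LocalAlg ι I₀ I₁} (hS : S ∈ h.scalars) :
    (fun μ => totalD μ S) ∈ h.covectors := h.mem_covectors.2 fun μ => by
  rw [h.map_totalD, h.mem_scalars.1 hS, lieScalar, (isTwistedDer_totalD μ).map_sum, lieCovector]
  refine Finset.sum_congr rfl fun ρ _ => ?_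
  rw [totalD_mul, totalD_comm, add_comm]

lemma contraction_mem_scalars (h : IsDiffeoOp K R) {X Y : Fin 4 → LocalAlg ι I₀ I₁}
    (hX : X ∈ h.covectors) (hY : Y ∈ h.covectors) :
    ∑ μ, ∑ ν, metInv μ ν * X μ * Y ν ∈ h.scalars :=
  h.isTwistedDer_frameVariation.contraction_mem_ker gradeInv_ofEven
    h.localMetric_map_frameVariation h.jacobian_mem_twistedCenter hX hY

lemma map_mul_volg (h : IsDiffeoOp K R) {S : LocalAlg ι I₀ I₁} (hS : S ∈ h.scalars) :
    R (S * volg) = ∑ ρ, totalD ρ (K ρ * (S * volg)) := by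
  have hF := h.isTwistedDer_frameVariation
  have hvol := hF.map_volg_eq_trace_mul gradeInv_ofEven h.localMetric_map_frameVariation
  have htrace : (jacobian K).trace ∈ twistedCenter gradeInv :=
    sum_mem fun ρ _ => h.jacobian_mem_twistedCenter ρ ρ
  calc R (S * volg)
      = frameVariation K R (S * volg) + lieScalar K (S * volg) := (sub_add_cancel _ _).symm
    _ = (jacobian K).trace * (S * volg) + lieScalar K (S * volg) := by
        rw [hF.leibniz, show frameVariation K R S = 0 from hS, zero_mul, zero_add, hvol,
          ← mul_assoc, ← htrace, mul_assoc]
    _ = ∑ ρ, totalD ρ (K ρ * (S * volg)) := by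
        simp only [totalD_mul _ (K _), Finset.sum_add_distrib, ← Finset.sum_mul]
        rfl

end IsDiffeoOp

end DiffeoOperators

namespace IsEvolutionary

variable {R : LocalAlg ι I₀ I₁ → LocalAlg ι I₀ I₁}

lemma map_mem_totalDerivatives (h : IsEvolutionary R) {X : LocalAlg ι I₀ I₁}
    (hX : X ∈ totalDerivatives ι I₀ I₁) : R X ∈ totalDerivatives ι I₀ I₁ := by
  obtain ⟨J, rfl⟩ := hX
  exact ⟨fun μ => R (J μ), by simp only [h.map_sum, h.map_totalD]⟩

lemma gradeInv_mem_ker (h : IsEvolutionary R) (X : LocalAlg ι I₀ I₁) (hX : X ∈ h.ker) :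
    gradeInv X ∈ h.ker := by
  change R (gradeInv X) = 0
  rw [h.map_gradeInv, show R X = 0 from hX, map_zero, neg_zero]

lemma totalD_mem_ker (h : IsEvolutionary R) (μ : Fin 4) {X : LocalAlg ι I₀ I₁} (hX : X ∈ h.ker) :
    totalD μ X ∈ h.ker := by
  change R (totalD μ X) = 0
  rw [h.map_totalD, show R X = 0 from hX, (isTwistedDer_totalD μ).map_zero]

end IsEvolutionary

section FieldDegrees

lemma fieldC_mem_homogeneous (ρ : Fin 4) : fieldC ρ ∈ homogeneous ι I₀ I₁ 1 :=
  oddCoord_mem_homogeneous _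

lemma fieldCbar_mem_homogeneous (ρ : Fin 4) : fieldCbar ρ ∈ homogeneous ι I₀ I₁ 1 :=
  oddCoord_mem_homogeneous _

lemma fieldc_mem_homogeneous (a : ι) : fieldc a ∈ homogeneous ι I₀ I₁ 1 :=
  oddCoord_mem_homogeneous _

lemma fieldcbar_mem_homogeneous (a : ι) : fieldcbar a ∈ homogeneous ι I₀ I₁ 1 :=
  oddCoord_mem_homogeneous _

lemma fieldB_mem_homogeneous (ρ : Fin 4) : fieldB ρ ∈ homogeneous ι I₀ I₁ 0 :=
  ofEven_mem_homogeneous _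

lemma fieldA_mem_homogeneous (a : ι) (μ : Fin 4) : fieldA a μ ∈ homogeneous ι I₀ I₁ 0 :=
  ofEven_mem_homogeneous _

lemma fieldb_mem_homogeneous (a : ι) : fieldb a ∈ homogeneous ι I₀ I₁ 0 :=
  ofEven_mem_homogeneous _

lemma evenMatter_mem_homogeneous (i : I₀) : evenMatter i ∈ homogeneous ι I₀ I₁ 0 :=
  ofEven_mem_homogeneous _

lemma oddMatter_mem_homogeneous (i : I₁) : oddMatter i ∈ homogeneous ι I₀ I₁ 1 :=
  oddCoord_mem_homogeneous _

end FieldDegrees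

section BRSTOperators

variable {𝔤 : Type*} [LieRing 𝔤] [LieAlgebra ℝ 𝔤] [Fintype I₀] [Fintype I₁] (ϰ ζ γ ξ : ℝ)
  (e : Module.Basis ι ℝ 𝔤) (M₀ : Multiplet 𝔤 I₀) (M₁ : Multiplet 𝔤 I₁)

open Submodule (smul_mem)

lemma isEvolutionary_opP :
    IsEvolutionary (opP ϰ ζ M₀ M₁ : LocalAlg ι I₀ I₁ → LocalAlg ι I₀ I₁) := by
  have hC := fieldC_mem_homogeneous (ι := ι) (I₀ := I₀) (I₁ := I₁)
  refine isEvolutionary_prolong (fun u => ?_) (fun θ => ?_)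
  · cases u with
    | metric p => exact smul_mem _ _ (lieMetricSym_mem_homogeneous hC p)
    | auxB ρ => exact zero_mem _
    | gauge a μ =>
      exact smul_mem _ _ (lieCovector_mem_homogeneous (m := 1) (n := 0) hC
        (fieldA_mem_homogeneous a) μ)
    | auxb a =>
      exact smul_mem _ _ (lieScalar_mem_homogeneous (m := 1) (n := 0) hC (fieldb_mem_homogeneous a))
    | matter i => exact smul_mem _ _ (lieMatter_mem_homogeneous M₀ hC evenMatter_mem_homogeneous i)
  · rw [← homogeneous_add_two]
    cases θ with
    | ghostC ρ => exact smul_mem _ _ (lieScalar_mem_homogeneous (m := 1) (n := 1) hC (hC ρ))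
    | antighostC ρ =>
      rw [homogeneous_add_two]
      exact smul_mem _ _ (fieldB_mem_homogeneous ρ)
    | ghostc a =>
      exact smul_mem _ _ (lieScalar_mem_homogeneous (m := 1) (n := 1) hC (fieldc_mem_homogeneous a))
    | antighostc a =>
      exact smul_mem _ _ (lieScalar_mem_homogeneous (m := 1) (n := 1) hC
        (fieldcbar_mem_homogeneous a))
    | matter i => exact smul_mem _ _ (lieMatter_mem_homogeneous M₁ hC oddMatter_mem_homogeneous i)

lemma isEvolutionary_opPbar :
    IsEvolutionary (opPbar ϰ ζ M₀ M₁ : LocalAlg ι I₀ I₁ → LocalAlg ι I₀ I₁) := by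
  have hCbar := fieldCbar_mem_homogeneous (ι := ι) (I₀ := I₀) (I₁ := I₁)
  have hbracket {n : ℕ} {X : Fin 4 → LocalAlg ι I₀ I₁} (hX : ∀ ρ, X ρ ∈ homogeneous ι I₀ I₁ n)
      (ρ : Fin 4) : ∑ σ, (fieldCbar σ * totalD σ (X ρ) - totalD σ (fieldCbar ρ) * X σ) ∈
        homogeneous ι I₀ I₁ (1 + n) :=
    sum_mem fun σ _ => sub_mem (mul_mem_homogeneous (hCbar σ) (totalD_mem_homogeneous σ (hX ρ)))
      (mul_mem_homogeneous (totalD_mem_homogeneous σ (hCbar ρ)) (hX σ))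
  refine isEvolutionary_prolong (fun u => ?_) (fun θ => ?_)
  · cases u with
    | metric p => exact smul_mem _ _ (lieMetricSym_mem_homogeneous hCbar p)
    | auxB ρ => exact smul_mem _ _ (hbracket fieldB_mem_homogeneous ρ)
    | gauge a μ =>
      exact smul_mem _ _ (lieCovector_mem_homogeneous (m := 1) (n := 0) hCbar
        (fieldA_mem_homogeneous a) μ)
    | auxb a =>
      exact smul_mem _ _ (lieScalar_mem_homogeneous (m := 1) (n := 0) hCbar
        (fieldb_mem_homogeneous a))
    | matter i =>
      exact smul_mem _ _ (lieMatter_mem_homogeneous M₀ hCbar evenMatter_mem_homogeneous i)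
  · rw [← homogeneous_add_two]
    cases θ with
    | ghostC ρ =>
      refine add_mem (neg_mem (smul_mem _ _ ?_))
        (smul_mem _ _ (hbracket fieldC_mem_homogeneous ρ))
      rw [homogeneous_add_two]
      exact fieldB_mem_homogeneous ρ
    | antighostC ρ =>
      exact smul_mem _ _ (lieScalar_mem_homogeneous (m := 1) (n := 1) hCbar (hCbar ρ))
    | ghostc a =>
      exact smul_mem _ _ (lieScalar_mem_homogeneous (m := 1) (n := 1) hCbar
        (fieldc_mem_homogeneous a))
    | antighostc a =>
      exact smul_mem _ _ (lieScalar_mem_homogeneous (m := 1) (n := 1) hCbar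
        (fieldcbar_mem_homogeneous a))
    | matter i =>
      exact smul_mem _ _ (lieMatter_mem_homogeneous M₁ hCbar oddMatter_mem_homogeneous i)

lemma isDiffeoOp_opP : IsDiffeoOp (ϰ • fieldC : Fin 4 → LocalAlg ι I₀ I₁) (opP ϰ ζ M₀ M₁) where
  __ := isEvolutionary_opP ϰ ζ M₀ M₁
  odd ρ := smul_mem _ _ (fieldC_mem_homogeneous ρ)
  map_met μ ν := (prolong_evenCoord _).trans (lieMetric_smul ϰ μ ν).symm

lemma isDiffeoOp_opPbar :
    IsDiffeoOp (ϰ • fieldCbar : Fin 4 → LocalAlg ι I₀ I₁) (opPbar ϰ ζ M₀ M₁) where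
  __ := isEvolutionary_opPbar ϰ ζ M₀ M₁
  odd ρ := smul_mem _ _ (fieldCbar_mem_homogeneous ρ)
  map_met μ ν := (prolong_evenCoord _).trans (lieMetric_smul ϰ μ ν).symm

variable [Fintype ι]

lemma isEvolutionary_opQ :
    IsEvolutionary (opQ γ ξ e M₀ M₁ : LocalAlg ι I₀ I₁ → LocalAlg ι I₀ I₁) := by
  have hc := fieldc_mem_homogeneous (ι := ι) (I₀ := I₀) (I₁ := I₁)
  refine isEvolutionary_prolong (fun u => ?_) (fun θ => ?_)
  · cases u with
    | metric p => exact zero_mem _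
    | auxB ρ => exact zero_mem _
    | gauge a μ =>
      exact add_mem (smul_mem _ _ (totalD_mem_homogeneous μ (hc a))) (smul_mem _ _
        (colorBracket_mem_homogeneous e hc (fun c => fieldA_mem_homogeneous c μ) a))
    | auxb a => exact zero_mem _
    | matter i =>
      exact smul_mem _ _ (gaugeMatter_mem_homogeneous M₀ e hc evenMatter_mem_homogeneous i)
  · rw [← homogeneous_add_two]
    cases θ with
    | ghostC ρ => exact zero_mem _
    | antighostC ρ => exact zero_mem _
    | ghostc a => exact smul_mem _ _ (colorBracket_mem_homogeneous e hc hc a)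
    | antighostc a =>
      rw [homogeneous_add_two]
      exact smul_mem _ _ (fieldb_mem_homogeneous a)
    | matter i =>
      exact smul_mem _ _ (gaugeMatter_mem_homogeneous M₁ e hc oddMatter_mem_homogeneous i)

lemma isEvolutionary_opQbar :
    IsEvolutionary (opQbar γ ξ e M₀ M₁ : LocalAlg ι I₀ I₁ → LocalAlg ι I₀ I₁) := by
  have hcbar := fieldcbar_mem_homogeneous (ι := ι) (I₀ := I₀) (I₁ := I₁)
  refine isEvolutionary_prolong (fun u => ?_) (fun θ => ?_)
  · cases u with
    | metric p => exact zero_mem _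
    | auxB ρ => exact zero_mem _
    | gauge a μ =>
      exact add_mem (smul_mem _ _ (totalD_mem_homogeneous μ (hcbar a))) (smul_mem _ _
        (colorBracket_mem_homogeneous e hcbar (fun c => fieldA_mem_homogeneous c μ) a))
    | auxb a =>
      exact smul_mem _ _ (colorBracket_mem_homogeneous e hcbar fieldb_mem_homogeneous a)
    | matter i =>
      exact smul_mem _ _ (gaugeMatter_mem_homogeneous M₀ e hcbar evenMatter_mem_homogeneous i)
  · rw [← homogeneous_add_two]
    cases θ with
    | ghostC ρ => exact zero_mem _
    | antighostC ρ => exact zero_mem _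
    | ghostc a =>
      refine add_mem (neg_mem (smul_mem _ _ ?_))
        (smul_mem _ _ (colorBracket_mem_homogeneous e hcbar fieldc_mem_homogeneous a))
      rw [homogeneous_add_two]
      exact fieldb_mem_homogeneous a
    | antighostc a => exact smul_mem _ _ (colorBracket_mem_homogeneous e hcbar hcbar a)
    | matter i =>
      exact smul_mem _ _ (gaugeMatter_mem_homogeneous M₁ e hcbar oddMatter_mem_homogeneous i)

end BRSTOperators

section GaugeFixing

variable {𝔤 : Type*} [LieRing 𝔤] [LieAlgebra ℝ 𝔤]

section Gravity

variable (ϰ ζ α : ℝ) {B : Subalgebra ℝ (LocalAlg ι I₀ I₁)}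

lemma bosonF_mem (hmet : ∀ μ ν, met μ ν ∈ B) (hC : ∀ ρ, fieldC ρ ∈ B)
    (hCbar : ∀ ρ, fieldCbar ρ ∈ B) : bosonF ϰ ζ α ∈ B := by
  refine B.smul_mem (sub_mem (B.smul_mem (sum_mem fun μ _ => sum_mem fun ν _ => ?_) _)
    (sum_mem fun ρ _ => mul_mem (hCbar ρ) (sum_mem fun σ _ => B.smul_mem (hC σ) _))) _
  exact B.smul_mem (B.smul_mem (sub_mem (hmet μ ν) (B.algebraMap_mem _)) _) _

variable [Fintype I₀] [Fintype I₁] (M₀ : Multiplet 𝔤 I₀) (M₁ : Multiplet 𝔤 I₁)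

lemma opPbar_met_mem (htotalD : ∀ μ, ∀ X ∈ B, totalD μ X ∈ B) (hmet : ∀ μ ν, met μ ν ∈ B)
    (hCbar : ∀ ρ, fieldCbar ρ ∈ B) (μ ν : Fin 4) : opPbar ϰ ζ M₀ M₁ (met μ ν) ∈ B := by
  rw [show opPbar ϰ ζ M₀ M₁ (met μ ν : LocalAlg ι I₀ I₁) = ϰ • lieMetric fieldCbar μ ν from
    prolong_evenCoord _]
  refine B.smul_mem (sum_mem fun ρ _ => add_mem (add_mem ?_ ?_) ?_) _
  · exact mul_mem (hCbar ρ) (htotalD ρ _ (hmet μ ν))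
  · exact mul_mem (htotalD μ _ (hCbar ρ)) (hmet ρ ν)
  · exact mul_mem (htotalD ν _ (hCbar ρ)) (hmet μ ρ)

lemma opPbar_fieldC_mem (htotalD : ∀ μ, ∀ X ∈ B, totalD μ X ∈ B) (hB : ∀ ρ, fieldB ρ ∈ B)
    (hC : ∀ ρ, fieldC ρ ∈ B) (hCbar : ∀ ρ, fieldCbar ρ ∈ B) (ρ : Fin 4) :
    opPbar ϰ ζ M₀ M₁ (fieldC ρ) ∈ B := by
  rw [show opPbar ϰ ζ M₀ M₁ (fieldC ρ : LocalAlg ι I₀ I₁) = -((1 / ζ) • fieldB ρ) +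
      ϰ • ∑ σ, (fieldCbar σ * totalD σ (fieldC ρ) - totalD σ (fieldCbar ρ) * fieldC σ) from
    prolong_oddCoord _]
  refine add_mem (neg_mem (B.smul_mem (hB ρ) _)) (B.smul_mem (sum_mem fun σ _ => ?_) _)
  exact sub_mem (mul_mem (hCbar σ) (htotalD σ _ (hC ρ)))
    (mul_mem (htotalD σ _ (hCbar ρ)) (hC σ))

lemma opPbar_fieldCbar_mem (htotalD : ∀ μ, ∀ X ∈ B, totalD μ X ∈ B)
    (hCbar : ∀ ρ, fieldCbar ρ ∈ B) (ρ : Fin 4) : opPbar ϰ ζ M₀ M₁ (fieldCbar ρ) ∈ B := by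
  rw [show opPbar ϰ ζ M₀ M₁ (fieldCbar ρ : LocalAlg ι I₀ I₁) =
    ϰ • ∑ σ, fieldCbar σ * totalD σ (fieldCbar ρ) from prolong_oddCoord _]
  exact B.smul_mem (sum_mem fun σ _ => mul_mem (hCbar σ) (htotalD σ _ (hCbar ρ))) _

end Gravity

section MetricConstant

variable {σ : LocalAlg ι I₀ I₁ →ₐ[ℝ] LocalAlg ι I₀ I₁} {d : LocalAlg ι I₀ I₁ → LocalAlg ι I₀ I₁}

namespace IsTwistedDer

open scoped Matrix

lemma localMetric_map_eq_zero (h : IsTwistedDer σ d) (hmet : ∀ μ ν, met μ ν ∈ h.ker) :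
    (localMetric ι I₀ I₁).map d = 0 * localMetric ι I₀ I₁ + localMetric ι I₀ I₁ * 0ᵀ := by
  rw [zero_mul, Matrix.transpose_zero, mul_zero, add_zero]
  exact Matrix.ext hmet

lemma volg_mem_ker (h : IsTwistedDer σ d) (hσ : ∀ a, σ (ofEven a) = ofEven a)
    (hmet : ∀ μ ν, met μ ν ∈ h.ker) : volg ∈ h.ker := by
  change d volg = 0
  rw [h.map_volg_eq_trace_mul hσ (h.localMetric_map_eq_zero hmet), Matrix.trace_zero, zero_mul]

lemma metInv_mem_ker (h : IsTwistedDer σ d) (hσ : ∀ a, σ (ofEven a) = ofEven a)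
    (hmet : ∀ μ ν, met μ ν ∈ h.ker) (μ ν : Fin 4) : metInv μ ν ∈ h.ker := by
  have hinv := h.map_inverse_matrix (h.localMetric_map_eq_zero hmet) localMetric_mul_localMetricInv
    localMetricInv_mul_localMetric (Matrix.ext fun _ _ => hσ _)
  rw [mul_zero, Matrix.transpose_zero, zero_mul, add_zero, neg_zero] at hinv
  exact congrFun (congrFun hinv μ) ν

end IsTwistedDer

end MetricConstant

namespace IsDiffeoOp

variable {K : Fin 4 → LocalAlg ι I₀ I₁} {R S : LocalAlg ι I₀ I₁ → LocalAlg ι I₀ I₁}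

lemma map_mul_volg_mem_totalDerivatives (h : IsDiffeoOp K R) {X : LocalAlg ι I₀ I₁}
    (hX : X ∈ h.scalars) : R (X * volg) ∈ totalDerivatives ι I₀ I₁ :=
  ⟨_, h.map_mul_volg hX⟩

lemma contraction_mem_stablePart (h : IsDiffeoOp K R) (hS : IsTwistedDer gradeInv S)
    (hmet : ∀ μ ν, met μ ν ∈ hS.ker) {X Y : Fin 4 → LocalAlg ι I₀ I₁}
    (hXeven : ∀ μ, X μ ∈ homogeneous ι I₀ I₁ 0) (hX : X ∈ h.covectors) (hY : Y ∈ h.covectors)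
    (hSX : (fun μ => S (X μ)) ∈ h.covectors) (hSY : (fun μ => S (Y μ)) ∈ h.covectors) :
    ∑ μ, ∑ ν, metInv μ ν * X μ * Y ν ∈ hS.stablePart h.scalars h.gradeInv_mem_scalars := by
  refine ⟨h.contraction_mem_scalars hX hY, ?_⟩
  have hleibniz : S (∑ μ, ∑ ν, metInv μ ν * X μ * Y ν) =
      ∑ μ, ∑ ν, metInv μ ν * S (X μ) * Y ν + ∑ μ, ∑ ν, metInv μ ν * X μ * S (Y ν) := by
    have hmetInv (μ ν : Fin 4) : S (metInv μ ν) = 0 := hS.metInv_mem_ker gradeInv_ofEven hmet μ ν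
    have hmetInv' (μ ν : Fin 4) : gradeInv (metInv μ ν : LocalAlg ι I₀ I₁) = metInv μ ν :=
      gradeInv_ofEven _
    have hX' (μ : Fin 4) : gradeInv (X μ) = X μ := by
      rw [mem_homogeneous_iff.1 (hXeven μ), pow_zero, one_smul]
    simp only [hS.map_sum, hS.leibniz, hmetInv, hmetInv', hX', map_mul, zero_mul, zero_add,
      Finset.sum_add_distrib]
  rw [hleibniz]
  exact add_mem (h.contraction_mem_scalars hSX hY) (h.contraction_mem_scalars hX hSY)

variable [Fintype ι]

lemma colorBracket_mem_scalars (h : IsDiffeoOp K R) (e : Module.Basis ι ℝ 𝔤)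
    {x y : ι → LocalAlg ι I₀ I₁} (hx : ∀ a, x a ∈ h.scalars) (hy : ∀ a, y a ∈ h.scalars) (a : ι) :
    colorBracket e x y a ∈ h.scalars :=
  sum_mem fun b _ => sum_mem fun c _ => h.scalars.smul_mem (mul_mem (hx b) (hy c)) _

lemma colorBracket_mem_covectors (h : IsDiffeoOp K R) (e : Module.Basis ι ℝ 𝔤)
    {x : ι → LocalAlg ι I₀ I₁} {X : ι → Fin 4 → LocalAlg ι I₀ I₁} (hx : ∀ a, x a ∈ h.scalars)
    (hX : ∀ a, X a ∈ h.covectors) (a : ι) :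
    (fun μ => colorBracket e x (fun c => X c μ) a) ∈ h.covectors := by
  have h' : ∑ b, ∑ c, structConst e a b c • (fun μ => x b * X c μ) ∈ h.covectors :=
    sum_mem fun b _ => sum_mem fun c _ =>
      h.covectors.smul_mem _ (h.mul_mem_covectors (hx b) (hX c))
  convert h' using 1
  ext μ
  simp only [colorBracket, Finset.sum_apply, Pi.smul_apply]

end IsDiffeoOp

section Tensors

variable [Fintype I₀] [Fintype I₁] (ϰ ζ : ℝ) (M₀ : Multiplet 𝔤 I₀) (M₁ : Multiplet 𝔤 I₁)

lemma fieldA_mem_covectors_opP (a : ι) :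
    fieldA a ∈ (isDiffeoOp_opP (ι := ι) ϰ ζ M₀ M₁).covectors :=
  (isDiffeoOp_opP ϰ ζ M₀ M₁).mem_covectors.2 fun μ =>
    (prolong_evenCoord _).trans (lieCovector_smul ϰ _ μ).symm

lemma fieldb_mem_scalars_opP (a : ι) : fieldb a ∈ (isDiffeoOp_opP (ι := ι) ϰ ζ M₀ M₁).scalars :=
  (isDiffeoOp_opP ϰ ζ M₀ M₁).mem_scalars.2 ((prolong_evenCoord _).trans (lieScalar_smul ϰ _).symm)

lemma fieldc_mem_scalars_opP (a : ι) : fieldc a ∈ (isDiffeoOp_opP (ι := ι) ϰ ζ M₀ M₁).scalars :=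
  (isDiffeoOp_opP ϰ ζ M₀ M₁).mem_scalars.2 ((prolong_oddCoord _).trans (lieScalar_smul ϰ _).symm)

lemma fieldcbar_mem_scalars_opP (a : ι) :
    fieldcbar a ∈ (isDiffeoOp_opP (ι := ι) ϰ ζ M₀ M₁).scalars :=
  (isDiffeoOp_opP ϰ ζ M₀ M₁).mem_scalars.2 ((prolong_oddCoord _).trans (lieScalar_smul ϰ _).symm)

end Tensors

section Density

variable [Fintype ι]

/-- The scalar by which the Yang–Mills gauge fixing boson multiplies the density
`-(ξ / 2) dV_g`. -/
noncomputable def gaugeFixingScalar (ι I₀ I₁ : Type*) [Fintype ι] : LocalAlg ι I₀ I₁ :=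
  ∑ a, ∑ μ, ∑ ν, metInv μ ν * fieldA a μ * fieldA a ν - ∑ a, fieldcbar a * fieldc a

lemma gaugeFixingScalar_mem {B : Subalgebra ℝ (LocalAlg ι I₀ I₁)}
    (hA : ∀ a, ∑ μ, ∑ ν, metInv μ ν * fieldA a μ * fieldA a ν ∈ B)
    (hc : ∀ a, fieldc a ∈ B) (hcbar : ∀ a, fieldcbar a ∈ B) : gaugeFixingScalar ι I₀ I₁ ∈ B :=
  sub_mem (sum_mem fun a _ => hA a) (sum_mem fun a _ => mul_mem (hcbar a) (hc a))

lemma IsTwistedDer.map_bosonG {σ : LocalAlg ι I₀ I₁ →ₐ[ℝ] LocalAlg ι I₀ I₁}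
    {d : LocalAlg ι I₀ I₁ → LocalAlg ι I₀ I₁} (h : IsTwistedDer σ d) (ξ : ℝ) :
    d (bosonG ξ) = (-(ξ / 2)) • d (gaugeFixingScalar ι I₀ I₁ * volg) :=
  h.map_smul _ _

variable [Fintype I₀] [Fintype I₁] (ϰ ζ γ ξ α : ℝ) (e : Module.Basis ι ℝ 𝔤) (M₀ : Multiplet 𝔤 I₀)
  (M₁ : Multiplet 𝔤 I₁)

lemma opPbar_bosonG_mem_totalDerivatives :
    opPbar ϰ ζ M₀ M₁ (bosonG ξ) ∈ totalDerivatives ι I₀ I₁ := by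
  have h : IsDiffeoOp (ϰ • fieldCbar) (opPbar ϰ ζ M₀ M₁ : LocalAlg ι I₀ I₁ → _) :=
    isDiffeoOp_opPbar ϰ ζ M₀ M₁
  have hA (a : ι) : fieldA a ∈ h.covectors := h.mem_covectors.2 fun μ =>
    (prolong_evenCoord _).trans (lieCovector_smul ϰ _ μ).symm
  have hc (a : ι) : fieldc a ∈ h.scalars :=
    h.mem_scalars.2 ((prolong_oddCoord _).trans (lieScalar_smul ϰ _).symm)
  have hcbar (a : ι) : fieldcbar a ∈ h.scalars :=
    h.mem_scalars.2 ((prolong_oddCoord _).trans (lieScalar_smul ϰ _).symm)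
  rw [h.map_bosonG]
  exact Submodule.smul_mem _ _ (h.map_mul_volg_mem_totalDerivatives
    (gaugeFixingScalar_mem (fun a => h.contraction_mem_scalars (hA a) (hA a)) hc hcbar))

lemma opQbar_fieldA_mem_covectors_opP (a : ι) :
    (fun μ => opQbar γ ξ e M₀ M₁ (fieldA a μ)) ∈ (isDiffeoOp_opP ϰ ζ M₀ M₁).covectors := by
  let h : IsDiffeoOp (ϰ • fieldC) (opP ϰ ζ M₀ M₁ : LocalAlg ι I₀ I₁ → _) :=
    isDiffeoOp_opP ϰ ζ M₀ M₁
  have hcbar : ∀ b, fieldcbar b ∈ h.scalars := fieldcbar_mem_scalars_opP ϰ ζ M₀ M₁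
  have hderiv : (fun μ => totalD μ (fieldcbar a)) ∈ h.covectors := h.totalD_mem_covectors (hcbar a)
  have hbracket : (fun μ => colorBracket e fieldcbar (fun c => fieldA c μ) a) ∈ h.covectors :=
    h.colorBracket_mem_covectors e hcbar (fieldA_mem_covectors_opP ϰ ζ M₀ M₁) a
  have hval : (fun μ => opQbar γ ξ e M₀ M₁ (fieldA a μ : LocalAlg ι I₀ I₁)) = fun μ =>
      (1 / ξ) • totalD μ (fieldcbar a) + γ • colorBracket e fieldcbar (fun c => fieldA c μ) a :=
    funext fun _ => prolong_evenCoord _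
  rw [hval]
  exact add_mem (h.covectors.smul_mem _ hderiv) (h.covectors.smul_mem _ hbracket)

lemma opQbar_fieldc_mem_scalars_opP (a : ι) :
    opQbar γ ξ e M₀ M₁ (fieldc a) ∈ (isDiffeoOp_opP ϰ ζ M₀ M₁).scalars := by
  rw [show opQbar γ ξ e M₀ M₁ (fieldc a) =
    -((1 / ξ) • fieldb a) + γ • colorBracket e fieldcbar fieldc a from prolong_oddCoord _]
  exact add_mem (neg_mem (Subalgebra.smul_mem _ (fieldb_mem_scalars_opP ϰ ζ M₀ M₁ a) _))
    (Subalgebra.smul_mem _ (IsDiffeoOp.colorBracket_mem_scalars _ e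
      (fieldcbar_mem_scalars_opP ϰ ζ M₀ M₁) (fieldc_mem_scalars_opP ϰ ζ M₀ M₁) a) _)

lemma opQbar_fieldcbar_mem_scalars_opP (a : ι) :
    opQbar γ ξ e M₀ M₁ (fieldcbar a) ∈ (isDiffeoOp_opP ϰ ζ M₀ M₁).scalars := by
  rw [show opQbar γ ξ e M₀ M₁ (fieldcbar a) =
    (γ / 2) • colorBracket e fieldcbar fieldcbar a from prolong_oddCoord _]
  exact Subalgebra.smul_mem _ (IsDiffeoOp.colorBracket_mem_scalars _ e
    (fieldcbar_mem_scalars_opP ϰ ζ M₀ M₁) (fieldcbar_mem_scalars_opP ϰ ζ M₀ M₁) a) _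

lemma opQbar_gaugeFixingScalar_mem_scalars_opP :
    opQbar γ ξ e M₀ M₁ (gaugeFixingScalar ι I₀ I₁) ∈ (isDiffeoOp_opP ϰ ζ M₀ M₁).scalars := by
  let h : IsDiffeoOp (ϰ • fieldC) (opP ϰ ζ M₀ M₁ : LocalAlg ι I₀ I₁ → _) :=
    isDiffeoOp_opP ϰ ζ M₀ M₁
  have hQbar := isEvolutionary_opQbar (I₀ := I₀) (I₁ := I₁) γ ξ e M₀ M₁
  have hA (a : ι) := fieldA_mem_covectors_opP ϰ ζ M₀ M₁ a
  have hQbarA (a : ι) := opQbar_fieldA_mem_covectors_opP ϰ ζ γ ξ e M₀ M₁ a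
  have hmem : gaugeFixingScalar ι I₀ I₁ ∈ hQbar.stablePart h.scalars h.gradeInv_mem_scalars :=
    gaugeFixingScalar_mem
      (fun a => h.contraction_mem_stablePart hQbar.toIsTwistedDer (fun μ ν => prolong_evenCoord _)
        (fieldA_mem_homogeneous a) (hA a) (hA a) (hQbarA a) (hQbarA a))
      (fun a => ⟨fieldc_mem_scalars_opP ϰ ζ M₀ M₁ a,
        opQbar_fieldc_mem_scalars_opP ϰ ζ γ ξ e M₀ M₁ a⟩)
      (fun a => ⟨fieldcbar_mem_scalars_opP ϰ ζ M₀ M₁ a,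
        opQbar_fieldcbar_mem_scalars_opP ϰ ζ γ ξ e M₀ M₁ a⟩)
  exact hmem.2

lemma opP_opQbar_bosonG_mem_totalDerivatives :
    opP ϰ ζ M₀ M₁ (opQbar γ ξ e M₀ M₁ (bosonG ξ)) ∈ totalDerivatives ι I₀ I₁ := by
  have hP : IsDiffeoOp (ϰ • fieldC) (opP ϰ ζ M₀ M₁ : LocalAlg ι I₀ I₁ → _) :=
    isDiffeoOp_opP ϰ ζ M₀ M₁
  have hQbar := isEvolutionary_opQbar (I₀ := I₀) (I₁ := I₁) γ ξ e M₀ M₁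
  have hvol : opQbar γ ξ e M₀ M₁ (volg : LocalAlg ι I₀ I₁) = 0 :=
    hQbar.volg_mem_ker gradeInv_ofEven fun μ ν => prolong_evenCoord _
  rw [hQbar.map_bosonG, hQbar.leibniz, hvol, mul_zero, add_zero, hP.map_smul]
  exact Submodule.smul_mem _ _ (hP.map_mul_volg_mem_totalDerivatives
    (opQbar_gaugeFixingScalar_mem_scalars_opP ϰ ζ γ ξ e M₀ M₁))

lemma opQbar_bosonF : opQbar γ ξ e M₀ M₁ (bosonF ϰ ζ α : LocalAlg ι I₀ I₁) = 0 :=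
  bosonF_mem ϰ ζ α (B := (isEvolutionary_opQbar γ ξ e M₀ M₁).ker)
    (fun _ _ => prolong_evenCoord _) (fun _ => prolong_oddCoord _) (fun _ => prolong_oddCoord _)

lemma opQ_opPbar_bosonF :
    opQ γ ξ e M₀ M₁ (opPbar ϰ ζ M₀ M₁ (bosonF ϰ ζ α : LocalAlg ι I₀ I₁)) = 0 := by
  have hQ := isEvolutionary_opQ (I₀ := I₀) (I₁ := I₁) γ ξ e M₀ M₁
  have hPbar : IsEvolutionary (opPbar ϰ ζ M₀ M₁ : LocalAlg ι I₀ I₁ → _) :=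
    isEvolutionary_opPbar ϰ ζ M₀ M₁
  have htotalD (μ : Fin 4) (X : LocalAlg ι I₀ I₁) (hX : X ∈ hQ.ker) := hQ.totalD_mem_ker μ hX
  have hmet (μ ν : Fin 4) : met μ ν ∈ hQ.ker := prolong_evenCoord _
  have hB (ρ : Fin 4) : fieldB ρ ∈ hQ.ker := prolong_evenCoord _
  have hC (ρ : Fin 4) : fieldC ρ ∈ hQ.ker := prolong_oddCoord _
  have hCbar (ρ : Fin 4) : fieldCbar ρ ∈ hQ.ker := prolong_oddCoord _
  exact (bosonF_mem ϰ ζ α (B := hPbar.stablePart hQ.ker hQ.gradeInv_mem_ker)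
    (fun μ ν => ⟨hmet μ ν, opPbar_met_mem ϰ ζ M₀ M₁ htotalD hmet hCbar μ ν⟩)
    (fun ρ => ⟨hC ρ, opPbar_fieldC_mem ϰ ζ M₀ M₁ htotalD hB hC hCbar ρ⟩)
    (fun ρ => ⟨hCbar ρ, opPbar_fieldCbar_mem ϰ ζ M₀ M₁ htotalD hCbar ρ⟩)).2

lemma superD_bosonB :
    superD ϰ ζ γ ξ e M₀ M₁ (bosonB ϰ ζ ξ α : LocalAlg ι I₀ I₁) =
      grGFGhost ϰ ζ α M₀ M₁ + ymGFGhost γ ξ e M₀ M₁ +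
        (opP ϰ ζ M₀ M₁ (opPbar ϰ ζ M₀ M₁ (bosonG ξ)) +
          opQ γ ξ e M₀ M₁ (opPbar ϰ ζ M₀ M₁ (bosonG ξ)) +
          opP ϰ ζ M₀ M₁ (opQbar γ ξ e M₀ M₁ (bosonG ξ))) := by
  have hP := isEvolutionary_opP (ι := ι) ϰ ζ M₀ M₁
  have hPbar := isEvolutionary_opPbar (ι := ι) ϰ ζ M₀ M₁
  have hQ := isEvolutionary_opQ γ ξ e M₀ M₁
  have hQbar := isEvolutionary_opQbar γ ξ e M₀ M₁
  simp only [grGFGhost, ymGFGhost, superP, superQ, superD, opD, opDbar, bosonB,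
    Function.comp_apply, Pi.add_apply, hP.map_add, hPbar.map_add, hQ.map_add, hQbar.map_add,
    opQbar_bosonF, opQ_opPbar_bosonF, hP.map_zero, hQ.map_zero]
  abel

end Density

end GaugeFixing

end BRST

theorem mainTheorem3 {𝔤 ι I₀ I₁ : Type*} [LieRing 𝔤] [LieAlgebra ℝ 𝔤] [Fintype ι]
    [Fintype I₀] [Fintype I₁]
    (e : Module.Basis ι ℝ 𝔤) (M₀ : BRST.Multiplet 𝔤 I₀) (M₁ : BRST.Multiplet 𝔤 I₁)
    (ϰ ζ γ ξ α : ℝ) (hϰ : ϰ ≠ 0) (hζ : ζ ≠ 0) (hξ : ξ ≠ 0) (hα : α ≠ 0) :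
    BRST.EqModTD
      (BRST.grGFGhost ϰ ζ α M₀ M₁ + BRST.ymGFGhost γ ξ e M₀ M₁ : BRST.LocalAlg ι I₀ I₁)
      (BRST.superD ϰ ζ γ ξ e M₀ M₁ (BRST.bosonB ϰ ζ ξ α)) := by
  have hP := BRST.isEvolutionary_opP (ι := ι) ϰ ζ M₀ M₁
  have hQ := BRST.isEvolutionary_opQ γ ξ e M₀ M₁
  have hPbarG := BRST.opPbar_bosonG_mem_totalDerivatives (ι := ι) ϰ ζ ξ M₀ M₁
  have hPPbarG := hP.map_mem_totalDerivatives hPbarG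
  have hQPbarG := hQ.map_mem_totalDerivatives hPbarG
  have hPQbarG := BRST.opP_opQbar_bosonG_mem_totalDerivatives ϰ ζ γ ξ e M₀ M₁
  change _ - _ ∈ BRST.totalDerivatives ι I₀ I₁
  rw [BRST.superD_bosonB, sub_add_cancel_left]
  exact neg_mem (add_mem (add_mem hPPbarG hQPbarG) hPQbarG)
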